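/- **Setting.** Let $\phi\in L^2(\mathbb R)$ be the scaling function of a multiresolution analysis of $L^2(\mathbb R)$: there are closed subspaces $V_j\subseteq V_{j+1}$ ($j\in\mathbb Z$) of $L^2(\mathbb R)$ with $\overline{\bigcup_j V_j}=L^2(\mathbb R)$, $\bigcap_j V_j=\{0\}$, $f\in V_j\iff f(2\,\cdot)\in V_{j+1}$, and such that $\{\phi(\cdot-k)\}_{k\in\mathbb Z}$ is a Riesz basis of $V_0$. Suppose that $\mathrm{supp}(\phi)\subseteq[-p+1,p]$ with $p\in\mathbb N$, and write $\phi_{j,k}(x)=2^{j/2}\phi(2^jx-k)$. Let $H$ be the space of all $f\in L^2(\mathbb R)$ that vanish outside $[0,1]$, and let $\hat f(\omega)=\int f(x)e^{-2\pi i\omega x}\,dx$. Let $\Omega=\{\omega_1<\dots<\omega_N\}\subseteq[-K,K]$, $N\ge1$. Put $\omega_0=\omega_N-2K$, $\omega_{N+1}=\omega_1+2K$, $\mu_n=\tfrac12(\omega_{n+1}-\omega_{n-1})$ and $$\mathcal S f=\sum_{n=1}^N\mu_n\hat f(\omega_n)e^{2\pi i\omega_n\cdot}\,\mathbb 1_{[0,1]},\qquad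 f\in H.$$ For a finite-dimensional subspace $T\subseteq H$, $T\neq\{0\}$, let $C_1$ be the largest constant with $\langle\mathcal Sf,f\rangle\ge C_1\|f\|^2$ for all $f\in T$, and $C_2$ the smallest constant with $\langle\mathcal Sf,f\rangle\le C_2\|f\|^2$ for all $f\in H$. The reconstruction constant is $C(\Omega,T)=\sqrt{C_2/C_1}$, understood as $+\infty$ if $C_1=0$. The wavelet reconstruction spaces at scale $R$ are the following spaces of functions on $[0,1]$ (extended by $0$). * *Periodic:* the span of $\phi_{R,k}^{\mathrm{per}}\mathbb 1_{[0,1]}$, $k=0,\dots,2^R-1$, where $f^{\mathrm{per}}(x)=\sum_{l\in\mathbb Z}f(x+l)$. * *Folded:* the span of $\phi_{R,k}^{\mathrm{fold}}\mathbb 1_{[0,1]}$, $k=0,\dots,2^R-\iota$, where $f^{\mathrm{fold}}(x)=\sum_{l\in\mathbb Z}f(x-2l)+\sum_{l\in\mathbb Z}f(2l-x)$ and $\iota\in\{0,1\}$ ($\iota=0$ for wavelets symmetric about $1/2$, $\iota=1$ for antisymmetric ones; the claim holds for both values). * *Boundary* (Cohen–Daubechies–Vial; for $2^R\ge2p$):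 the span of $\phi_{R,k}$, $p\le k<2^R-p$, together with $\phi^{\mathrm{left}}_k(2^R\,\cdot)\mathbb 1_{[0,1]}$ and $\phi^{\mathrm{right}}_k(2^R(\cdot-1))\mathbb 1_{[0,1]}$, $0\le k<p$, where $$\phi^{\mathrm{left}}_k(x)=\mathbb 1_{[0,\infty)}(x)\sum_{n=k}^{2p-2}\binom nk\phi(x+n-p+1),$$ and $\phi^{\mathrm{right}}_k(x)$ is the value at $-x$ of the left function built in the same way from $\phi(1-\cdot)$. (Orthonormalizing these functions does not change the span.) **Theorem 6.1.** There are constants $c_1,c_2>0$ depending only on $\phi$ (and on the choice of $p$) such that the following holds. Let $K>\frac{2}{\pi^2}+\frac12$, let $\Omega\subseteq[-K,K]$ and $\mathcal S$ be as above, let $R$ be such that $2^{R-1}>K$, and let $T$ be the periodic, a folded, or (if $2^R\ge2p$) the boundary wavelet reconstruction space at scale $R$. Then $$C(\Omega,T)\ \ge\ \frac{c_1}{\sqrt K}\,\exp\bigl(c_2(1-z)2^R\bigr),\qquad z=\max\Bigl\{\tfrac12,\ \frac{K}{2^{R-1}}\Bigr\}.$$ -/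

import Mathlib

open MeasureTheory Complex
open scoped ENNReal FourierTransform

noncomputable section

/-! ### Subspaces of the space of square-integrable functions on the line -/

/-- The complex Hilbert space `L²(ℝ)`. -/
abbrev L2R : Type := Lp ℂ 2 (volume : Measure ℝ)

/-- The function `f` is square-integrable and its class belongs to the subspace `V`. -/
def FunMem (V : Submodule ℂ L2R) (f : ℝ → ℂ) : Prop :=
  ∃ g ∈ V, g =ᵐ[volume] f

/-- The linear span in `L²(ℝ)` of a family of square-integrable functions. -/
def funSpan {ι : Type} (u : ι → ℝ → ℂ) : Submodule ℂ L2R :=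
  Submodule.span ℂ {g : L2R | ∃ i, g =ᵐ[volume] u i}

/-- The space `H` of all `f ∈ L²(ℝ)` that vanish (almost everywhere) outside `[0,1]`. -/
def unitIntervalSpace : Submodule ℂ L2R where
  carrier := {f | ∀ᵐ x ∂(volume : Measure ℝ), x ∉ Set.Icc (0 : ℝ) 1 → f x = 0}
  add_mem' := by
    intro a b ha hb
    filter_upwards [ha, hb, Lp.coeFn_add a b] with x hxa hxb hx h
    rw [hx, Pi.add_apply, hxa h, hxb h, add_zero]
  zero_mem' := by
    filter_upwards [Lp.coeFn_zero ℂ 2 (volume : Measure ℝ)] with x hx _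
    rw [hx, Pi.zero_apply]
  smul_mem' := by
    intro c a ha
    filter_upwards [ha, Lp.coeFn_smul c a] with x hxa hx h
    rw [hx, Pi.smul_apply, hxa h, smul_zero]

/-! ### Multiresolution analyses -/

/-- `u` is a Riesz basis of the closed subspace `V`: its closed span is `V`, and
`d₁ ∑ |αₖ|² ≤ ‖∑ αₖ uₖ‖² ≤ d₂ ∑ |αₖ|²` for some `d₁, d₂ > 0` and all finitely supported (hence,
by density, all square-summable) coefficients. -/
def IsRieszBasisOf (u : ℤ → L2R) (V : Submodule ℂ L2R) : Prop :=
  (Submodule.span ℂ (Set.range u)).topologicalClosure = V ∧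
  ∃ d₁ d₂ : ℝ, 0 < d₁ ∧ 0 < d₂ ∧ ∀ α : ℤ →₀ ℂ,
    d₁ * ∑ k ∈ α.support, ‖α k‖ ^ 2 ≤ ‖∑ k ∈ α.support, α k • u k‖ ^ 2 ∧
    ‖∑ k ∈ α.support, α k • u k‖ ^ 2 ≤ d₂ * ∑ k ∈ α.support, ‖α k‖ ^ 2

/-- `V` is a multiresolution analysis of `L²(ℝ)` with scaling function `φ`. -/
structure IsMRA (V : ℤ → Submodule ℂ L2R) (φ : ℝ → ℂ) : Prop where
  isClosed : ∀ j, IsClosed (V j : Set L2R)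
  nested : ∀ j, V j ≤ V (j + 1)
  dense_iUnion : Dense (⋃ j, (V j : Set L2R))
  iInf_eq_bot : ⨅ j, V j = ⊥
  dilation : ∀ (j : ℤ) (f : ℝ → ℂ), FunMem (V j) f ↔ FunMem (V (j + 1)) (fun x => f (2 * x))
  riesz : ∃ u : ℤ → L2R, (∀ k : ℤ, u k =ᵐ[volume] fun x => φ (x - k)) ∧ IsRieszBasisOf u (V 0)

/-- `φ` is the scaling function of some multiresolution analysis of `L²(ℝ)`. -/
def IsScalingFunction (φ : ℝ → ℂ) : Prop :=
  ∃ V : ℤ → Submodule ℂ L2R, IsMRA V φ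

/-! ### Wavelet spaces on `[0,1]` -/

/-- `2^{j/2} g(2^j x)`. -/
def dilate (j : ℕ) (g : ℝ → ℂ) (x : ℝ) : ℂ :=
  (Real.sqrt (2 ^ j) : ℂ) * g (2 ^ j * x)

/-- `φ_{j,k}(x) = 2^{j/2} φ(2^j x - k)`. -/
def scaled (φ : ℝ → ℂ) (j : ℕ) (k : ℤ) : ℝ → ℂ :=
  dilate j (fun x => φ (x - k))

/-- Periodization `∑ₗ f(x + l)`. For compactly supported `f` the sum is finite at each `x`. -/
def periodize (f : ℝ → ℂ) (x : ℝ) : ℂ :=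
  ∑' l : ℤ, f (x + l)

/-- Folding `∑ₗ f(x - 2l) + ∑ₗ f(2l - x)`. For compactly supported `f` the sums are finite at
each `x`. -/
def fold (f : ℝ → ℂ) (x : ℝ) : ℂ :=
  (∑' l : ℤ, f (x - 2 * l)) + (∑' l : ℤ, f (2 * l - x))

/-- The periodic space at scale `R`: the span of `φ^per_{R,k}`, `k = 0, …, 2^R - 1`, regarded as
functions on `[0,1]`. -/
def periodicSpace (φ : ℝ → ℂ) (R : ℕ) : Submodule ℂ L2R :=
  funSpan fun k : {k : ℤ // 0 ≤ k ∧ k ≤ 2 ^ R - 1} =>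
    Set.indicator (Set.Icc (0 : ℝ) 1) (periodize (scaled φ R k))

/-- The folded space at scale `R`: the span of `φ^fold_{R,k}`, `k = 0, …, 2^R - i`, regarded as
functions on `[0,1]`; here `i` is `0` or `1`. -/
def foldedSpace (φ : ℝ → ℂ) (i : ℤ) (R : ℕ) : Submodule ℂ L2R :=
  funSpan fun k : {k : ℤ // 0 ≤ k ∧ k ≤ 2 ^ R - i} =>
    Set.indicator (Set.Icc (0 : ℝ) 1) (fold (scaled φ R k))

/-- The left edge function of Cohen, Daubechies and Vial,
`∑_{n=k}^{2p-2} (n choose k) φ(x + n - p + 1)` restricted to `x ≥ 0`, for `k = 0, …, p - 1`.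
(The boundary scaling functions are obtained from these `p` functions by Gram-Schmidt
orthonormalization, which does not change their span.) -/
def leftEdge (φ : ℝ → ℂ) (p k : ℕ) : ℝ → ℂ :=
  Set.indicator (Set.Ici (0 : ℝ)) fun x =>
    ∑ n ∈ Finset.Icc k (2 * p - 2), (n.choose k : ℂ) * φ (x + n - p + 1)

/-- The right edge function, the mirror image on `x ≤ 0` of the left edge function that belongs
to the mirrored scaling function `φ(1 - ·)` (whose support also lies in `[-p+1,p]`). -/
def rightEdge (φ : ℝ → ℂ) (p k : ℕ) (x : ℝ) : ℂ :=
  leftEdge (fun y => φ (1 - y)) p k (-x)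

/-- The function with index `k`, `0 ≤ k ≤ 2^j - 1`, of the boundary-adapted system at scale `j`
on `[0,1]`, for `2p ≤ 2^j`. -/
def boundaryScaled (φ : ℝ → ℂ) (p j k : ℕ) : ℝ → ℂ :=
  if k < p then dilate j (leftEdge φ p k)
  else if k < 2 ^ j - p then scaled φ j k
  else fun x => dilate j (rightEdge φ p (2 ^ j - k - 1)) (x - 1)

/-- The boundary-adapted space at scale `R`, for `2p ≤ 2^R`. -/
def boundarySpace (φ : ℝ → ℂ) (p R : ℕ) : Submodule ℂ L2R :=
  funSpan fun k : {k : ℕ // k < 2 ^ R} =>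
    Set.indicator (Set.Icc (0 : ℝ) 1) (boundaryScaled φ p R k)

/-- `T` is a reconstruction space at scale `R` of periodic, folded or boundary wavelets with
scaling function `φ` supported in `[-p+1,p]`. It is spanned by all wavelets of scale below `R`
together with the scaling functions of the coarsest scale, that is, by the scaling functions of
scale `R`. -/
def IsWaveletSpace (φ : ℝ → ℂ) (p R : ℕ) (T : Submodule ℂ L2R) : Prop :=
  T = periodicSpace φ R ∨
  (∃ i : ℤ, (i = 0 ∨ i = 1) ∧ T = foldedSpace φ i R) ∨
  (2 * p ≤ 2 ^ R ∧ T = boundarySpace φ p R)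

/-! ### Nonuniform Fourier sampling -/

/-- The frequencies `ω₁, …, ω_N` extended by `ω₀ = ω_N - 2K` and `ω_{N+1} = ω₁ + 2K`. -/
def extendedFreq (K : ℝ) (N : ℕ) (ω : ℕ → ℝ) (n : ℕ) : ℝ :=
  if n = 0 then ω N - 2 * K else if n = N + 1 then ω 1 + 2 * K else ω n

/-- The weights `μₙ = (ω_{n+1} - ω_{n-1}) / 2`, `n = 1, …, N`. -/
def weight (K : ℝ) (N : ℕ) (ω : ℕ → ℝ) (n : ℕ) : ℝ :=
  (extendedFreq K N ω (n + 1) - extendedFreq K N ω (n - 1)) / 2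

/-- `x ↦ e^{2πi ω x}` on `[0,1]`, zero elsewhere. -/
def windowedExp (ω : ℝ) : ℝ → ℂ :=
  Set.indicator (Set.Icc (0 : ℝ) 1) fun x => cexp (2 * Real.pi * I * ω * x)

theorem memLp_windowedExp (ω : ℝ) : MemLp (windowedExp ω) 2 (volume : Measure ℝ) := by
  refine (memLp_indicator_iff_restrict measurableSet_Icc).2 ?_
  refine MemLp.of_bound (C := 1) ?_ ?_
  · exact Continuous.aestronglyMeasurable (by fun_prop)
  · refine Filter.Eventually.of_forall fun x => le_of_eq ?_
    have h : (2 * Real.pi * I * ω * x : ℂ) = ((2 * Real.pi * ω * x : ℝ) : ℂ) * I := by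
      push_cast
      ring
    rw [h, norm_exp_ofReal_mul_I]

/-- The weighted sampling operator `S f = ∑ₙ μₙ f̂(ωₙ) e^{2πi ωₙ ·} 𝟙_{[0,1]}` (used for `f ∈ H`;
`f̂(ω) = ∫ f(x) e^{-2πi ω x} dx`). -/
def samplingOp (K : ℝ) (N : ℕ) (ω : ℕ → ℝ) (f : L2R) : L2R :=
  ∑ n ∈ Finset.Icc 1 N,
    ((weight K N ω n : ℂ) * 𝓕 (f : ℝ → ℂ) (ω n)) •
      (memLp_windowedExp (ω n)).toLp (windowedExp (ω n))

/-- The largest `C₁` with `⟨S f, f⟩ ≥ C₁ ‖f‖²` for all `f ∈ T`. -/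
def lowerConst (S : L2R → L2R) (T : Submodule ℂ L2R) : ℝ≥0∞ :=
  sSup {c : ℝ≥0∞ | ∀ f ∈ T, c * ENNReal.ofReal (‖f‖ ^ 2) ≤ ENNReal.ofReal (inner ℂ f (S f)).re}

/-- The smallest `C₂` with `⟨S f, f⟩ ≤ C₂ ‖f‖²` for all `f ∈ H`. -/
def upperConst (S : L2R → L2R) : ℝ≥0∞ :=
  sInf {c : ℝ≥0∞ | ∀ f ∈ unitIntervalSpace,
    ENNReal.ofReal (inner ℂ f (S f)).re ≤ c * ENNReal.ofReal (‖f‖ ^ 2)}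

/-- The reconstruction constant `C = √(C₂ / C₁)`. It is finite exactly if `C₁ > 0`, that is, if
the sampling operator is admissible for `T`, and it is `∞` otherwise (here `0 < C₂ < ∞`). -/
def reconstructionConst (K : ℝ) (N : ℕ) (ω : ℕ → ℝ) (T : Submodule ℂ L2R) : ℝ≥0∞ :=
  (upperConst (samplingOp K N ω) / lowerConst (samplingOp K N ω) T) ^ (1 / 2 : ℝ)

end

/-! `C₂` is bounded below by an absolute constant, and `C₁` is bounded above by a single test
function in `T` whose Fourier transform is tiny on `[-K, K]`.

For `C₂`: the form is `⟨Sf, f⟩ = ∑ μₙ |f̂(ωₙ)|²`, with nonnegative weights of total mass `2K`.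
Summed over the integer exponentials with frequency up to about `K`, it is at least a fixed multiple
of `K`, because each `ωₙ` lies within `1/2` of one of these integers. There are only about `2K` of
them, so some Rayleigh quotient is bounded below (`le_upperConst`).

For `C₁`: scaling functions supported inside `(0,1)` belong to each of the wavelet spaces unchanged.
A combination of `2n+1` consecutive ones has Fourier transform `2^{-R/2} Q(e^{-2πi x/2^R})
φ̂(x/2^R)` up to a phase, where `Q` is the polynomial of its coefficients. On `[-K, K]` the argument
of `Q` stays in the arc `|t| ≤ πz`. A Chebyshev polynomial in `cos t`, rescaled to be at most `1` on
this arc, reaches `cosh(n(1-z))` at `-1`, so its coefficients are large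
(`exists_polynomial_small_on_arc`). The lower Riesz bound turns large coefficients into a large norm
(`IsWaveletSpace.exists_concentrated`). As `n` is `2^{R-1}` up to a constant, the quotient is
exponentially small in `(1-z)2^R`.

If `2^{R-1} ≤ p` there is no room for this combination, but then the exponential is bounded and the
trivial bound `C₁ ≤ 2K` suffices. It needs a nonzero element of `T`, which is where the sums of
translates come in (`IsWaveletSpace.exists_mem_ne_zero`). -/

/-! ### Windowed exponentials and the quadratic form of the sampling operator. -/

/-- The class of the windowed exponential in `L²(ℝ)`. -/
noncomputable def expVec (ω : ℝ) : L2R := (memLp_windowedExp ω).toLp (windowedExp ω)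

theorem expVec_coe (ω : ℝ) : expVec ω =ᵐ[volume] windowedExp ω := MemLp.coeFn_toLp _

theorem expVec_mem (ω : ℝ) : expVec ω ∈ unitIntervalSpace := by
  change ∀ᵐ x ∂volume, x ∉ Set.Icc (0 : ℝ) 1 → expVec ω x = 0
  filter_upwards [expVec_coe ω] with x hx h
  rw [hx, windowedExp, Set.indicator_of_notMem h]

theorem fourier_eq_inner {f : L2R} (hf : f ∈ unitIntervalSpace) (ω : ℝ) :
    𝓕 (f : ℝ → ℂ) ω = inner ℂ (expVec ω) f := by
  rw [L2.inner_def, Real.fourier_real_eq_integral_exp_smul]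
  refine integral_congr_ae ?_
  have hf' : ∀ᵐ x ∂volume, x ∉ Set.Icc (0 : ℝ) 1 → f x = 0 := hf
  filter_upwards [expVec_coe ω, hf'] with x hx h
  rw [hx]
  by_cases hm : x ∈ Set.Icc (0 : ℝ) 1
  · rw [windowedExp, Set.indicator_of_mem hm, RCLike.inner_apply, ← Complex.exp_conj, smul_eq_mul,
      mul_comm]
    congr 2
    simp only [map_mul, conj_I, conj_ofReal, map_ofNat]
    push_cast
    ring
  · rw [h hm]; simp

theorem inner_samplingOp {f : L2R} (hf : f ∈ unitIntervalSpace) (K : ℝ) (N : ℕ) (ω : ℕ → ℝ) :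
    (inner ℂ f (samplingOp K N ω f)).re
      = ∑ n ∈ Finset.Icc 1 N, weight K N ω n * ‖(inner ℂ (expVec (ω n)) f : ℂ)‖ ^ 2 := by
  rw [samplingOp, inner_sum, Complex.re_sum]
  refine Finset.sum_congr rfl fun n _ => ?_
  rw [inner_smul_right, fourier_eq_inner hf]
  change ((weight K N ω n : ℂ) * inner ℂ (expVec (ω n)) f * inner ℂ f (expVec (ω n))).re = _
  rw [← inner_conj_symm f (expVec (ω n)), mul_assoc, Complex.mul_conj, ← Complex.ofReal_mul,
    Complex.ofReal_re, Complex.normSq_eq_norm_sq]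

theorem inner_expVec (a b : ℝ) :
    inner ℂ (expVec a) (expVec b)
      = ∫ x in (0 : ℝ)..1, cexp ((2 * Real.pi * (b - a) * x : ℝ) * I) := by
  rw [L2.inner_def, intervalIntegral.integral_of_le zero_le_one, ← integral_Icc_eq_integral_Ioc,
    ← integral_indicator measurableSet_Icc]
  refine integral_congr_ae ?_
  filter_upwards [expVec_coe a, expVec_coe b] with x hx hy
  rw [hx, hy]
  by_cases hm : x ∈ Set.Icc (0 : ℝ) 1
  · rw [windowedExp, windowedExp, Set.indicator_of_mem hm, Set.indicator_of_mem hm,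
      Set.indicator_of_mem hm, RCLike.inner_apply, ← Complex.exp_conj, ← Complex.exp_add]
    congr 1
    simp only [map_mul, conj_I, conj_ofReal, map_ofNat]
    push_cast
    ring
  · rw [windowedExp, windowedExp, Set.indicator_of_notMem hm, Set.indicator_of_notMem hm,
      Set.indicator_of_notMem hm]
    simp

theorem norm_expVec (a : ℝ) : ‖expVec a‖ = 1 := by
  have h : inner ℂ (expVec a) (expVec a) = (1 : ℂ) := by
    rw [inner_expVec]
    simp
  have h2 : ‖expVec a‖ ^ 2 = 1 := by
    rw [@norm_sq_eq_re_inner ℂ, h]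
    simp
  nlinarith [norm_nonneg (expVec a)]

/-- After removal of the phase at the midpoint of `[0,1]`, the inner product is the integral of
`cos(s(2x-1))` with `s = π(b-a)`. The bound `cos y ≥ 1 - y²/2` makes it at least `1 - s²/6`, and `s²
≤ π²/4 ≤ 5/2`. -/
theorem half_le_norm_inner_expVec {a b : ℝ} (h : |b - a| ≤ 1 / 2) :
    1 / 2 ≤ ‖(inner ℂ (expVec a) (expVec b) : ℂ)‖ := by
  set s := Real.pi * (b - a) with hs
  have hs2 : s ^ 2 ≤ 5 / 2 := by
    have h1 : (b - a) ^ 2 ≤ (1 / 2) ^ 2 := sq_le_sq' (by linarith [(abs_le.1 h).1]) (abs_le.1 h).2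
    have h2 : Real.pi ^ 2 ≤ 10 := by nlinarith [Real.pi_gt_three, Real.pi_lt_d2]
    rw [hs, mul_pow]
    nlinarith [sq_nonneg (b - a), sq_nonneg Real.pi]
  have key : 1 / 2 ≤ ∫ x in (0 : ℝ)..1, Real.cos (s * (2 * x - 1)) := by
    have h0 : ∫ x in (0 : ℝ)..1, (1 - s ^ 2 / 2 * (2 * x - 1) ^ 2) = 1 - s ^ 2 / 6 := by
      have : ∀ x : ℝ, HasDerivAt (fun x : ℝ => x - s ^ 2 / 12 * (2 * x - 1) ^ 3)
          (1 - s ^ 2 / 2 * (2 * x - 1) ^ 2) x := by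
        intro x
        have h1 : HasDerivAt (fun x : ℝ => 2 * x - 1) (2 * 1) x :=
          ((hasDerivAt_id x).const_mul 2).sub_const 1
        refine ((hasDerivAt_id x).sub ((h1.pow 3).const_mul (s ^ 2 / 12))).congr_deriv ?_
        push_cast
        ring
      rw [intervalIntegral.integral_eq_sub_of_hasDerivAt (fun x _ => this x)
        (Continuous.intervalIntegrable (by fun_prop) _ _)]
      ring
    calc (1 : ℝ) / 2 ≤ 1 - s ^ 2 / 6 := by linarith
      _ = _ := h0.symm
      _ ≤ _ := by
        refine intervalIntegral.integral_mono_on zero_le_one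
          (Continuous.intervalIntegrable (by fun_prop) _ _)
          (Continuous.intervalIntegrable (by fun_prop) _ _) fun x _ => ?_
        have := Real.one_sub_sq_div_two_le_cos (x := s * (2 * x - 1))
        rw [mul_pow] at this
        linarith
  have hre : (cexp ((-s : ℝ) * I) * inner ℂ (expVec a) (expVec b)).re
      = ∫ x in (0 : ℝ)..1, Real.cos (s * (2 * x - 1)) := by
    rw [inner_expVec, ← intervalIntegral.integral_const_mul]
    have : (∫ x in (0 : ℝ)..1, cexp ((-s : ℝ) * I) * cexp ((2 * Real.pi * (b - a) * x : ℝ) * I)).re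
      = ∫ x in (0 : ℝ)..1,
        (cexp ((-s : ℝ) * I) * cexp ((2 * Real.pi * (b - a) * x : ℝ) * I)).re := by
      have h := Complex.reCLM.intervalIntegral_comp_comm (μ := volume) (a := 0) (b := 1)
        (f := fun x : ℝ => cexp ((-s : ℝ) * I) * cexp ((2 * Real.pi * (b - a) * x : ℝ) * I))
        (Continuous.intervalIntegrable (by fun_prop) _ _)
      exact h.symm
    rw [this]
    refine intervalIntegral.integral_congr fun x _ => ?_
    rw [← Complex.exp_add, ← add_mul, ← Complex.ofReal_add, Complex.exp_ofReal_mul_I_re]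
    congr 1
    rw [hs]
    ring
  calc (1 : ℝ) / 2 ≤ _ := key
    _ = _ := hre.symm
    _ ≤ _ := Complex.re_le_norm _
    _ = _ := by rw [norm_mul, norm_exp_ofReal_mul_I, one_mul]

/-! ### Bounds for the two frame constants in terms of the weights. -/

section weights

variable {K : ℝ} {N : ℕ} {ω : ℕ → ℝ}

/-- The differences telescope in steps of two, leaving `(ω_{N+1} + ω_N - ω_1 - ω_0)/2`; the cyclic
extension of the frequencies makes this `2K`. -/
theorem sum_weight (K : ℝ) {N : ℕ} (hN : 1 ≤ N) (ω : ℕ → ℝ) :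
    ∑ n ∈ Finset.Icc 1 N, weight K N ω n = 2 * K := by
  have h : ∀ M : ℕ, ∑ n ∈ Finset.Icc 1 M, weight K N ω n
      = (extendedFreq K N ω (M + 1) + extendedFreq K N ω M
        - extendedFreq K N ω 1 - extendedFreq K N ω 0) / 2 := by
    intro M
    induction M with
    | zero => simp
    | succ M ih =>
      rw [Finset.sum_Icc_succ_top (by omega), ih, weight, Nat.add_sub_cancel]
      ring
  rw [h N]
  have h2 : N ≠ 0 := by omega
  simp [extendedFreq, h2]
  ring

theorem weight_nonneg (hω : StrictMonoOn ω (Set.Icc 1 N))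
    (hK : ∀ n ∈ Set.Icc 1 N, ω n ∈ Set.Icc (-K) K) {n : ℕ} (hn : n ∈ Finset.Icc 1 N) :
    0 ≤ weight K N ω n := by
  obtain ⟨h1, h2⟩ := Finset.mem_Icc.1 hn
  have hm : ∀ a b, 1 ≤ a → a ≤ b → b ≤ N → ω a ≤ ω b := fun a b h h' h'' =>
    hω.monotoneOn ⟨h, h'.trans h''⟩ ⟨h.trans h', h''⟩ h'
  have ha := hK 1 ⟨le_rfl, by omega⟩
  have hb := hK N ⟨by omega, le_rfl⟩
  have hl : extendedFreq K N ω (n - 1) ≤ ω n := by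
    unfold extendedFreq
    split_ifs with h3 h4
    · have := hK n ⟨h1, h2⟩
      linarith [this.1, hb.2]
    · omega
    · exact hm _ _ (by omega) (by omega) h2
  have hr : ω n ≤ extendedFreq K N ω (n + 1) := by
    unfold extendedFreq
    rw [if_neg (by omega)]
    split_ifs with h3
    · have := hK n ⟨h1, h2⟩
      linarith [this.2, ha.1]
    · exact hm _ _ h1 (by omega) (by omega)
  unfold weight
  linarith

theorem samplingOp_re_le (hN : 1 ≤ N) (hω : StrictMonoOn ω (Set.Icc 1 N))
    (hK : ∀ n ∈ Set.Icc 1 N, ω n ∈ Set.Icc (-K) K) {f : L2R} (hf : f ∈ unitIntervalSpace) {B : ℝ}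
    (hB : ∀ x ∈ Set.Icc (-K) K, ‖𝓕 (f : ℝ → ℂ) x‖ ^ 2 ≤ B) :
    (inner ℂ f (samplingOp K N ω f)).re ≤ 2 * K * B := by
  rw [inner_samplingOp hf, ← sum_weight K hN ω, Finset.sum_mul]
  refine Finset.sum_le_sum fun n hn => ?_
  refine mul_le_mul_of_nonneg_left ?_ (weight_nonneg hω hK hn)
  rw [← fourier_eq_inner hf]
  exact hB _ (hK n (by simpa using hn))

theorem norm_fourier_le {f : L2R} (hf : f ∈ unitIntervalSpace) (x : ℝ) :
    ‖𝓕 (f : ℝ → ℂ) x‖ ≤ ‖f‖ := by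
  rw [fourier_eq_inner hf]
  simpa [norm_expVec] using norm_inner_le_norm (𝕜 := ℂ) (expVec x) f

/-- An averaging argument: the form is summed over the exponentials with integer frequencies `|k| ≤
m`, and the order of summation is exchanged. Each sample `ωₙ` contributes at least `μₙ/4` through
its nearest integer. -/
theorem le_upperConst (h1 : 1 / 2 < K) (hN : 1 ≤ N) (hω : StrictMonoOn ω (Set.Icc 1 N))
    (hK : ∀ n ∈ Set.Icc 1 N, ω n ∈ Set.Icc (-K) K) :
    ENNReal.ofReal (1 / 12) ≤ upperConst (samplingOp K N ω) := by
  refine le_sInf fun c hc => ?_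
  rcases eq_or_ne c ⊤ with rfl | hc'
  · exact le_top
  rw [← ENNReal.ofReal_toReal hc']
  refine ENNReal.ofReal_le_ofReal ?_
  set r := c.toReal with hr
  have hr0 : 0 ≤ r := ENNReal.toReal_nonneg
  have hre : ∀ x, (inner ℂ (expVec x) (samplingOp K N ω (expVec x))).re ≤ r := by
    intro x
    have h := hc _ (expVec_mem x)
    rw [norm_expVec, one_pow, ENNReal.ofReal_one, mul_one, ← ENNReal.ofReal_toReal hc',
      ENNReal.ofReal_le_ofReal_iff hr0] at h
    exact h
  -- The least range certain to contain the rounding of every point of `[-K, K]`; it has at most `2K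
  -- + 2` integers.
  set m : ℤ := ⌊K + 1 / 2⌋ with hm
  have hm0 : 0 ≤ m := Int.floor_nonneg.2 (by linarith)
  have hm1 : (m : ℝ) ≤ K + 1 / 2 := Int.floor_le _
  have hcard : (Finset.Icc (-m) m).card • r ≤ (2 * K + 2) * r := by
    rw [nsmul_eq_mul]
    refine mul_le_mul_of_nonneg_right ?_ hr0
    rw [Int.card_Icc]
    have h2 : (((m + 1 - -m).toNat : ℤ) : ℝ) = ((m + 1 - -m : ℤ) : ℝ) := by
      rw [Int.toNat_of_nonneg (by omega)]
    rw [Int.cast_natCast] at h2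
    rw [h2]
    push_cast
    linarith
  have hsum : 2 * K * (1 / 4) ≤ (2 * K + 2) * r := by
    calc 2 * K * (1 / 4) = ∑ n ∈ Finset.Icc 1 N, weight K N ω n * (1 / 4) := by
          rw [← sum_weight K hN ω, Finset.sum_mul]
      _ ≤ ∑ n ∈ Finset.Icc 1 N, weight K N ω n *
            ∑ k ∈ Finset.Icc (-m) m, ‖(inner ℂ (expVec (ω n)) (expVec k) : ℂ)‖ ^ 2 := by
          refine Finset.sum_le_sum fun n hn => ?_
          refine mul_le_mul_of_nonneg_left ?_ (weight_nonneg hω hK hn)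
          have hb := hK n (by simpa using hn)
          have hround := abs_sub_round (ω n)
          have hr2 := abs_le.1 hround
          have hmem : round (ω n) ∈ Finset.Icc (-m) m := by
            rw [Finset.mem_Icc]
            constructor
            · rw [neg_le, hm, Int.le_floor]
              push_cast
              linarith [hb.1]
            · rw [hm, Int.le_floor]
              linarith [hb.2]
          have h3 := half_le_norm_inner_expVec (a := ω n) (b := round (ω n))
            (by rw [abs_sub_comm]; exact hround)
          have h4 := Finset.single_le_sum
            (f := fun k : ℤ => ‖(inner ℂ (expVec (ω n)) (expVec k) : ℂ)‖ ^ 2)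
            (fun i _ => sq_nonneg _) hmem
          refine le_trans ?_ h4
          nlinarith
      _ = ∑ k ∈ Finset.Icc (-m) m, (inner ℂ (expVec k) (samplingOp K N ω (expVec k))).re := by
          simp_rw [Finset.mul_sum]
          rw [Finset.sum_comm]
          exact Finset.sum_congr rfl fun k _ => (inner_samplingOp (expVec_mem k) K N ω).symm
      _ ≤ (Finset.Icc (-m) m).card • r := Finset.sum_le_card_nsmul _ _ _ fun k _ => hre k
      _ ≤ _ := hcard
  -- `K/2 ≤ (2K+2) r` gives `r ≥ K/(4K+4)`, which is at least `1/12` for `K ≥ 1/2`.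
  by_contra! hlt
  nlinarith

/-- One Rayleigh quotient bounds `C₁` from above. The test vector must be nonzero: on the zero
subspace `lowerConst` is `∞`. -/
theorem le_reconstructionConst (h1 : 1 / 2 < K) (hN : 1 ≤ N) (hω : StrictMonoOn ω (Set.Icc 1 N))
    (hK : ∀ n ∈ Set.Icc 1 N, ω n ∈ Set.Icc (-K) K) {T : Submodule ℂ L2R} {f : L2R} (hf : f ∈ T)
    (hf0 : f ≠ 0) {B : ℝ} (hB0 : 0 < B)
    (hB : (inner ℂ f (samplingOp K N ω f)).re ≤ B * ‖f‖ ^ 2) :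
    ENNReal.ofReal (Real.sqrt (1 / 12 / B)) ≤ reconstructionConst K N ω T := by
  have hlow : lowerConst (samplingOp K N ω) T ≤ ENNReal.ofReal B := by
    refine sSup_le fun c hc => ?_
    have h := (hc f hf).trans (ENNReal.ofReal_le_ofReal hB)
    rw [ENNReal.ofReal_mul hB0.le] at h
    have hpos : ENNReal.ofReal (‖f‖ ^ 2) ≠ 0 := by
      rw [Ne, ENNReal.ofReal_eq_zero, not_le]
      have := norm_pos_iff.2 hf0
      positivity
    exact (ENNReal.mul_le_mul_iff_left hpos ENNReal.ofReal_ne_top).1 h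
  rw [reconstructionConst, Real.sqrt_eq_rpow, ← ENNReal.ofReal_rpow_of_nonneg (by positivity)
    (by norm_num), ENNReal.ofReal_div_of_pos hB0]
  exact ENNReal.rpow_le_rpow (ENNReal.div_le_div (le_upperConst h1 hN hω hK) hlow) (by norm_num)

end weights

/-! ### Chebyshev polynomials on an arc of the unit circle. -/

open Polynomial in
/-- A polynomial of degree at most `2 n` that represents `q (A (w + w⁻¹) / 2 + B)` up to the
factor `w ^ n`. -/
theorem exists_polynomial_joukowski (q : ℝ[X]) {n : ℕ} (hq : q.natDegree ≤ n) (A B : ℝ) :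
    ∃ Q : ℂ[X], Q.natDegree ≤ 2 * n ∧ ∀ t : ℝ,
      Q.eval (cexp (t * I)) = cexp (t * I) ^ n * (q.eval (A * Real.cos t + B) : ℝ) := by
  -- For `w = e^{it}` one has `w cos t = (w² + 1)/2`, so the last factor is `wⁱ (A cos t + B)ⁱ`; the
  -- factor `X ^ (n - i)` pads every term to the same power `wⁿ`.
  refine ⟨∑ i ∈ Finset.range (n + 1),
    C ((q.coeff i : ℝ) : ℂ) * X ^ (n - i) * (C ((A / 2 : ℝ) : ℂ) * (X ^ 2 + 1) + C (B : ℂ) * X) ^ i,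
    ?_, fun t => ?_⟩
  · refine natDegree_sum_le_of_forall_le _ _ fun i hi => ?_
    have hi' : i ≤ n := Nat.lt_succ_iff.1 (Finset.mem_range.1 hi)
    have h1 : (C ((A / 2 : ℝ) : ℂ) * (X ^ 2 + 1) + C (B : ℂ) * X).natDegree ≤ 2 := by
      compute_degree
    have h2 := natDegree_pow_le_of_le i h1
    have h3 : (C ((q.coeff i : ℝ) : ℂ) * X ^ (n - i)).natDegree ≤ n - i :=
      natDegree_C_mul_X_pow_le _ _
    exact (natDegree_mul_le_of_le h3 h2).trans (by omega)
  · rw [eval_finsetSum, eval_eq_sum_range' (Nat.lt_succ_of_le hq)]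
    push_cast
    rw [Finset.mul_sum]
    refine Finset.sum_congr rfl fun i hi => ?_
    have hi' : i ≤ n := Nat.lt_succ_iff.1 (Finset.mem_range.1 hi)
    have hw : cexp (t * I) * cexp (-t * I) = 1 := by rw [← Complex.exp_add]; simp
    have hc : (A / 2 : ℂ) * (cexp (t * I) ^ 2 + 1) + B * cexp (t * I)
        = cexp (t * I) * (A * Complex.cos t + B) := by
      rw [Complex.cos]
      linear_combination (-(A : ℂ) / 2) * hw
    simp only [eval_mul, eval_C, eval_pow, eval_X, eval_add, eval_one]
    rw [hc, mul_pow, ← pow_sub_mul_pow (cexp (t * I)) hi']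
    ring

theorem abs_eval_chebyshev_le_one (n : ℤ) {x : ℝ} (h : |x| ≤ 1) :
    |(Polynomial.Chebyshev.T ℝ n).eval x| ≤ 1 := by
  rw [← Real.cos_arccos (abs_le.1 h).1 (abs_le.1 h).2, Polynomial.Chebyshev.T_real_cos]
  exact Real.abs_cos_le_one _

/-- `T_n(cosh u) = cosh(nu)` gives the growth to the right of `1`; parity of `T_n` carries it to the
left of `-1`. -/
theorem cosh_le_abs_eval_chebyshev (n : ℕ) {s x : ℝ} (hs : 0 ≤ s) (h : x ≤ -Real.cosh s) :
    Real.cosh (n * s) ≤ |(Polynomial.Chebyshev.T ℝ n).eval x| := by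
  have h1 : 1 ≤ -x := (Real.one_le_cosh s).trans (by linarith)
  have h2 : (Polynomial.Chebyshev.T ℝ n).eval (-x) = Real.cosh (n * Real.arcosh (-x)) := by
    conv_lhs => rw [← Real.cosh_arcosh h1]
    rw [Polynomial.Chebyshev.T_real_cosh]
    simp
  have h3 : |(Polynomial.Chebyshev.T ℝ n).eval x| = |(Polynomial.Chebyshev.T ℝ n).eval (-x)| := by
    rw [Polynomial.Chebyshev.T_eval_neg, abs_mul]
    rcases Int.even_or_odd (n : ℤ) with he | he
    · simp [Int.negOnePow_even _ he]
    · simp [Int.negOnePow_odd _ he]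
  have ha : 0 ≤ Real.arcosh (-x) := Real.arcosh_nonneg h1
  have hsa : s ≤ Real.arcosh (-x) := by
    have : Real.cosh s ≤ Real.cosh (Real.arcosh (-x)) := by rw [Real.cosh_arcosh h1]; linarith
    rw [Real.cosh_le_cosh, abs_of_nonneg hs, abs_of_nonneg ha] at this
    exact this
  rw [h3, h2, abs_of_nonneg (Real.cosh_pos _).le, Real.cosh_le_cosh, abs_of_nonneg (by positivity),
    abs_of_nonneg (by positivity)]
  exact mul_le_mul_of_nonneg_left hsa (by positivity)

theorem cosh_le_one_add_sq {s : ℝ} (h0 : 0 ≤ s) (h1 : s ≤ 1) : Real.cosh s ≤ 1 + s ^ 2 := by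
  refine (Real.cosh_le_exp_half_sq s).trans ?_
  have h2 : |s ^ 2 / 2| ≤ 1 := by rw [abs_of_nonneg (by positivity)]; nlinarith
  have := Real.abs_exp_sub_one_le h2
  rw [abs_of_nonneg (by positivity : (0 : ℝ) ≤ s ^ 2 / 2)] at this
  linarith [(abs_le.1 this).2]

/-- A polynomial of degree at most `2 n` bounded by `1` on the arc `|t| ≤ π z` of the unit circle
and large at `-1`, relative to the degree. -/
theorem exists_polynomial_small_on_arc (n : ℕ) {z : ℝ} (hz : 1 / 2 ≤ z) (hz1 : z ≤ 1) :
    ∃ Q : Polynomial ℂ,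
      (∀ t : ℝ, |t| ≤ Real.pi * z → ‖Q.eval (cexp (t * I))‖ ≤ 1) ∧
      Real.cosh (n * (1 - z)) ^ 2
        ≤ (2 * n + 1) * ∑ k ∈ Finset.range (2 * n + 1), ‖Q.coeff k‖ ^ 2 ∧
      Q.natDegree < 2 * n + 1 := by
  set c := Real.cos (Real.pi * z) with hc
  have hc0 : c ≤ 0 := Real.cos_nonpos_of_pi_div_two_le_of_le
    (by nlinarith [Real.pi_pos]) (by nlinarith [Real.pi_pos])
  have hcm : -1 ≤ c := Real.neg_one_le_cos _
  -- `1 + cos(πz) = 2 sin²(π(1-z)/2)`, and Jordan's inequality bounds the sine below by `1 - z`.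
  have hc1 : 2 * (1 - z) ^ 2 ≤ 1 + c := by
    have h1 : c = -Real.cos (2 * (Real.pi / 2 * (1 - z))) := by
      rw [hc, ← Real.cos_pi_sub]; congr 1; ring
    have h2 := Real.mul_le_sin (x := Real.pi / 2 * (1 - z))
      (mul_nonneg (by positivity) (by linarith)) (by nlinarith [Real.pi_pos])
    have h3 : 2 / Real.pi * (Real.pi / 2 * (1 - z)) = 1 - z := by
      field_simp [Real.pi_ne_zero]
    rw [h3] at h2
    rw [h1, Real.cos_two_mul, Real.cos_sq']
    nlinarith
  -- The affine map `y ↦ Ay + B` takes `[c, 1]`, the values of `cos t` on the arc, onto `[-1, 1]`.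
  -- It sends `cos π = -1` to `-(3+c)/(1-c)`, which lies below `-1` by at least `1 + c`.
  set A := 2 / (1 - c) with hA
  set B := -(1 + c) / (1 - c) with hB
  have hd : 0 < 1 - c := by linarith
  obtain ⟨Q, hQd, hQ⟩ := exists_polynomial_joukowski (Polynomial.Chebyshev.T ℝ n) (n := n)
    (by rw [Polynomial.Chebyshev.natDegree_T]; simp) A B
  have hnorm : ∀ t : ℝ, ‖Q.eval (cexp (t * I))‖
      = |(Polynomial.Chebyshev.T ℝ n).eval (A * Real.cos t + B)| := by
    intro t
    rw [hQ, norm_mul, norm_pow, norm_exp_ofReal_mul_I, one_pow, one_mul, Complex.norm_real,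
      Real.norm_eq_abs]
  refine ⟨Q, fun t ht => ?_, ?_, by omega⟩
  · rw [hnorm]
    refine abs_eval_chebyshev_le_one _ ?_
    have h1 : c ≤ Real.cos t := by
      rw [hc, ← Real.cos_abs t]
      exact Real.cos_le_cos_of_nonneg_of_le_pi (abs_nonneg _) (by nlinarith [Real.pi_pos]) ht
    have h2 := Real.cos_le_one t
    have h3 : A * Real.cos t + B = (2 * Real.cos t - (1 + c)) / (1 - c) := by
      rw [hA, hB]; ring
    rw [h3, abs_le, le_div_iff₀ hd, div_le_iff₀ hd]
    constructor <;> linarith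
  · have h1 : Real.cosh (n * (1 - z)) ≤ ‖Q.eval (cexp (Real.pi * I))‖ := by
      rw [hnorm]
      refine cosh_le_abs_eval_chebyshev n (by linarith) ?_
      have h2 := cosh_le_one_add_sq (s := 1 - z) (by linarith) (by linarith)
      have h3 : A * Real.cos Real.pi + B = -(3 + c) / (1 - c) := by
        rw [hA, hB, Real.cos_pi]; ring
      rw [h3, div_le_iff₀ hd]
      nlinarith [sq_nonneg (1 - z)]
    have h2 : ‖Q.eval (cexp (Real.pi * I))‖
        ≤ ∑ k ∈ Finset.range (2 * n + 1), ‖Q.coeff k‖ := by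
      rw [Polynomial.eval_eq_sum_range' (Nat.lt_succ_of_le hQd)]
      refine (norm_sum_le _ _).trans (le_of_eq (Finset.sum_congr rfl fun k _ => ?_))
      rw [norm_mul, norm_pow, norm_exp_ofReal_mul_I, one_pow, mul_one]
    -- Cauchy–Schwarz passes from the `ℓ¹` norm of the coefficients, which dominates `|Q(-1)|`, to
    -- their `ℓ²` norm.
    have h3 := sq_sum_le_card_mul_sum_sq (s := Finset.range (2 * n + 1))
      (f := fun k => ‖Q.coeff k‖)
    rw [Finset.card_range] at h3
    push_cast at h3
    exact (pow_le_pow_left₀ (Real.cosh_pos _).le (h1.trans h2) 2).trans h3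

/-! ### Spans of functions, the Riesz bound, and dilation in `L²`. -/

theorem coeFn_sum_smul {ι : Type*} (s : Finset ι) (c : ι → ℂ) (g : ι → L2R) (u : ι → ℝ → ℂ)
    (h : ∀ i ∈ s, g i =ᵐ[volume] u i) :
    (∑ i ∈ s, c i • g i : L2R) =ᵐ[volume] fun x => ∑ i ∈ s, c i * u i x := by
  classical
  induction s using Finset.induction_on with
  | empty =>
    simp only [Finset.sum_empty]
    exact Lp.coeFn_zero ℂ 2 volume
  | insert a s ha ih =>
    rw [Finset.sum_insert ha]
    filter_upwards [ih fun i hi => h i (Finset.mem_insert_of_mem hi),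
      h a (Finset.mem_insert_self a s), Lp.coeFn_add (c a • g a) (∑ i ∈ s, c i • g i),
      Lp.coeFn_smul (c a) (g a)] with x h1 h2 h3 h4
    rw [h3, Pi.add_apply, h4, Pi.smul_apply, h1, h2, Finset.sum_insert ha, smul_eq_mul]

theorem FunMem.sum_mul {ι : Type*} {V : Submodule ℂ L2R} {s : Finset ι} {u : ι → ℝ → ℂ}
    (h : ∀ i ∈ s, FunMem V (u i)) (c : ι → ℂ) : FunMem V fun x => ∑ i ∈ s, c i * u i x := by
  choose! g hg using h
  exact ⟨∑ i ∈ s, c i • g i, V.sum_mem fun i hi => V.smul_mem _ (hg i hi).1,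
    coeFn_sum_smul s c g u fun i hi => (hg i hi).2⟩

/-- `funSpan` silently ignores generators that are not square-integrable, hence the integrability
hypothesis. -/
theorem funMem_funSpan {ι : Type} {u : ι → ℝ → ℂ} {i : ι} (h : MemLp (u i) 2 volume) :
    FunMem (funSpan u) (u i) :=
  ⟨h.toLp _, Submodule.subset_span ⟨i, h.coeFn_toLp⟩, h.coeFn_toLp⟩

theorem funSpan_indicator_le {ι : Type} (u : ι → ℝ → ℂ) :
    funSpan (fun i => Set.indicator (Set.Icc (0 : ℝ) 1) (u i)) ≤ unitIntervalSpace := by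
  refine Submodule.span_le.2 ?_
  rintro g ⟨i, hi⟩
  change ∀ᵐ x ∂volume, x ∉ Set.Icc (0 : ℝ) 1 → g x = 0
  filter_upwards [hi] with x hx h
  rw [hx, Set.indicator_of_notMem h]

theorem IsWaveletSpace.le_unitIntervalSpace {φ : ℝ → ℂ} {p R : ℕ} {T : Submodule ℂ L2R}
    (hT : IsWaveletSpace φ p R T) : T ≤ unitIntervalSpace := by
  rcases hT with rfl | ⟨i, -, rfl⟩ | ⟨-, rfl⟩ <;> exact funSpan_indicator_le _

/-- The lower Riesz bound `d` for the integer translates of `φ ∈ L²(ℝ)`. -/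
structure HasLowerRieszBound (φ : ℝ → ℂ) (d : ℝ) : Prop where
  memLp : MemLp φ 2 volume
  le : ∀ (s : Finset ℤ) (β : ℤ → ℂ), d * ∑ k ∈ s, ‖β k‖ ^ 2
    ≤ (eLpNorm (fun x => ∑ k ∈ s, β k * φ (x - k)) 2 volume).toReal ^ 2

theorem IsScalingFunction.exists_hasLowerRieszBound {φ : ℝ → ℂ} (hφ : IsScalingFunction φ) :
    ∃ d : ℝ, 0 < d ∧ HasLowerRieszBound φ d := by
  obtain ⟨V, hV⟩ := hφ
  obtain ⟨u, hu, -, d₁, d₂, hd₁, -, h⟩ := hV.riesz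
  refine ⟨d₁, hd₁, ?_, fun s β => ?_⟩
  · have h0 : u 0 =ᵐ[volume] φ := by simpa using hu 0
    exact (memLp_congr_ae h0).1 (Lp.memLp (u 0))
  · have h1 := (h (Finsupp.indicator s fun k _ => β k)).1
    have hsub : (Finsupp.indicator s fun k _ => β k).support ⊆ s :=
      Finsupp.support_indicator_subset _ _
    rw [Finset.sum_subset hsub (fun k _ hk => by rw [Finsupp.notMem_support_iff.1 hk]; simp),
      Finset.sum_subset hsub (fun k _ hk => by rw [Finsupp.notMem_support_iff.1 hk]; simp)] at h1
    have h2 : ∀ k ∈ s, (Finsupp.indicator s fun k _ => β k) k = β k := fun k hk => by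
      simp [Finsupp.indicator_apply, hk]
    rw [Finset.sum_congr rfl fun k hk => by rw [h2 k hk],
      Finset.sum_congr (g := fun k => β k • u k) rfl fun k hk => by rw [h2 k hk], Lp.norm_def,
      eLpNorm_congr_ae (coeFn_sum_smul s β u _ fun k _ => hu k)] at h1
    exact h1

theorem MemLp.comp_sub_const {g : ℝ → ℂ} (hg : MemLp g 2 volume) (a : ℝ) :
    MemLp (fun x => g (x - a)) 2 volume :=
  hg.comp_measurePreserving (measurePreserving_sub_right volume a)

theorem eLpNorm_comp_sub_const {g : ℝ → ℂ} (hg : MemLp g 2 volume) (a : ℝ) :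
    eLpNorm (fun x => g (x - a)) 2 volume = eLpNorm g 2 volume :=
  eLpNorm_comp_measurePreserving hg.1 (measurePreserving_sub_right volume a)

theorem aestronglyMeasurable_comp_mul {g : ℝ → ℂ} (hg : AEStronglyMeasurable g volume) {a : ℝ}
    (ha : a ≠ 0) : AEStronglyMeasurable (fun x => g (a * x)) volume := by
  refine hg.comp_quasiMeasurePreserving ⟨by fun_prop, ?_⟩
  rw [Real.map_volume_mul_left ha]
  exact Measure.smul_absolutelyContinuous

theorem eLpNorm_dilate {g : ℝ → ℂ} (hg : AEStronglyMeasurable g volume) (j : ℕ) :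
    eLpNorm (dilate j g) 2 volume = eLpNorm g 2 volume := by
  have ha : (0 : ℝ) < 2 ^ j := by positivity
  have h1 : dilate j g = (Real.sqrt (2 ^ j) : ℂ) • (g ∘ fun x => 2 ^ j * x) := rfl
  have h2 : eLpNorm (g ∘ fun x : ℝ => 2 ^ j * x) 2 volume
      = ENNReal.ofReal ((2 ^ j : ℝ)⁻¹) ^ (1 / 2 : ℝ) * eLpNorm g 2 volume := by
    have h3 : AEStronglyMeasurable g (Measure.map (fun x : ℝ => 2 ^ j * x) volume) := by
      rw [Real.map_volume_mul_left ha.ne']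
      exact hg.mono_ac Measure.smul_absolutelyContinuous
    rw [← eLpNorm_map_measure h3 (by fun_prop), Real.map_volume_mul_left ha.ne',
      eLpNorm_smul_measure_of_ne_top (by simp), abs_of_pos (by positivity)]
    simp
  rw [h1, eLpNorm_const_smul, h2, ← mul_assoc, ENNReal.ofReal_rpow_of_nonneg (by positivity)
    (by norm_num), ← Real.sqrt_eq_rpow]
  have h4 : ‖(Real.sqrt (2 ^ j) : ℂ)‖ₑ = ENNReal.ofReal (Real.sqrt (2 ^ j)) := by
    rw [← ofReal_norm, Complex.norm_real, Real.norm_of_nonneg (Real.sqrt_nonneg _)]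
  rw [h4, ← ENNReal.ofReal_mul (Real.sqrt_nonneg _), ← Real.sqrt_mul ha.le, mul_inv_cancel₀ ha.ne']
  simp

theorem MemLp.dilate {g : ℝ → ℂ} (hg : MemLp g 2 volume) (j : ℕ) :
    MemLp (dilate j g) 2 volume := by
  refine ⟨(aestronglyMeasurable_comp_mul hg.1 (by positivity)).const_mul _, ?_⟩
  rw [eLpNorm_dilate hg.1]
  exact hg.2

theorem memLp_scaled {φ : ℝ → ℂ} (hφ : MemLp φ 2 volume) (j : ℕ) (k : ℤ) :
    MemLp (scaled φ j k) 2 volume :=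
  MemLp.dilate (MemLp.comp_sub_const hφ k) j

/-! ### Interior scaling functions belong to every wavelet space. -/

theorem indicator_periodize_of_support {g : ℝ → ℂ} (hg : Function.support g ⊆ Set.Ioo 0 1) :
    Set.indicator (Set.Icc (0 : ℝ) 1) (periodize g) = g := by
  have h0 : ∀ y, y ∉ Set.Ioo (0 : ℝ) 1 → g y = 0 := fun y hy => by
    by_contra h
    exact hy (hg h)
  ext x
  by_cases hx : x ∈ Set.Icc (0 : ℝ) 1
  · rw [Set.indicator_of_mem hx, periodize, tsum_eq_single 0]
    · simp
    · intro l hl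
      refine h0 _ fun hm => hl ?_
      have h1 : (l : ℝ) < 1 := by linarith [hm.2, hx.1]
      have h2 : (-1 : ℝ) < l := by linarith [hm.1, hx.2]
      have h3 : l < 1 := by exact_mod_cast h1
      have h4 : -1 < l := by exact_mod_cast h2
      omega
  · rw [Set.indicator_of_notMem hx, h0 x fun h => hx (Set.Ioo_subset_Icc_self h)]

theorem indicator_fold_of_support {g : ℝ → ℂ} (hg : Function.support g ⊆ Set.Ioo 0 1) :
    Set.indicator (Set.Icc (0 : ℝ) 1) (fold g) = g := by
  have h0 : ∀ y, y ∉ Set.Ioo (0 : ℝ) 1 → g y = 0 := fun y hy => by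
    by_contra h
    exact hy (hg h)
  ext x
  by_cases hx : x ∈ Set.Icc (0 : ℝ) 1
  · rw [Set.indicator_of_mem hx, fold, tsum_eq_single 0, tsum_eq_single 0]
    · rw [h0 (2 * (0 : ℤ) - x) fun h => by
        have := h.1
        push_cast at this
        linarith [hx.1]]
      simp
    · intro l hl
      refine h0 _ fun hm => ?_
      have h1 : (0 : ℝ) < l := by linarith [hm.1, hx.1]
      have h2 : (l : ℝ) < 1 := by linarith [hm.2, hx.2]
      have h3 : 0 < l := by exact_mod_cast h1
      have h4 : l < 1 := by exact_mod_cast h2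
      omega
    · intro l hl
      refine h0 _ fun hm => ?_
      have h1 : (-1 : ℝ) < l := by linarith [hm.2, hx.1]
      have h2 : (l : ℝ) < 1 := by linarith [hm.1, hx.2]
      have h3 : -1 < l := by exact_mod_cast h1
      have h4 : l < 1 := by exact_mod_cast h2
      omega
  · rw [Set.indicator_of_notMem hx, h0 x fun h => hx (Set.Ioo_subset_Icc_self h)]

theorem support_scaled_subset {φ : ℝ → ℂ} {p : ℕ}
    (hsupp : Function.support φ ⊆ Set.Icc (-(p : ℝ) + 1) p) {R : ℕ} {k : ℤ} (h1 : p ≤ k)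
    (h2 : k ≤ 2 ^ R - p - 1) : Function.support (scaled φ R k) ⊆ Set.Ioo 0 1 := by
  intro x hx
  have h3 := hsupp (right_ne_zero_of_mul hx : φ (2 ^ R * x - k) ≠ 0)
  have h4 : (p : ℝ) ≤ k := by exact_mod_cast h1
  have h5 : (k : ℝ) ≤ 2 ^ R - p - 1 := by exact_mod_cast h2
  have h6 : (0 : ℝ) < 2 ^ R := by positivity
  obtain ⟨h7, h8⟩ := h3
  constructor
  · by_contra! h
    nlinarith
  · by_contra! h
    nlinarith

/-- For these `k` the support lies in the open interval `(0,1)`, where periodizing and folding add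
nothing; in the boundary system they are the interior functions. -/
theorem IsWaveletSpace.funMem_scaled {φ : ℝ → ℂ} {p R : ℕ} {T : Submodule ℂ L2R}
    (hT : IsWaveletSpace φ p R T) (hφ : MemLp φ 2 volume)
    (hsupp : Function.support φ ⊆ Set.Icc (-(p : ℝ) + 1) p) {k : ℤ} (h1 : p ≤ k)
    (h2 : k ≤ 2 ^ R - p - 1) : FunMem T (scaled φ R k) := by
  have hs := support_scaled_subset hsupp h1 h2
  have hm := memLp_scaled hφ R k
  rcases hT with rfl | ⟨i, hi, rfl⟩ | ⟨-, rfl⟩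
  · have := funMem_funSpan (u := fun k : {k : ℤ // 0 ≤ k ∧ k ≤ 2 ^ R - 1} =>
      Set.indicator (Set.Icc (0 : ℝ) 1) (periodize (scaled φ R k)))
      (i := ⟨k, by omega, by omega⟩) (by simpa only [indicator_periodize_of_support hs] using hm)
    simp only [indicator_periodize_of_support hs] at this
    exact this
  · have := funMem_funSpan (u := fun k : {k : ℤ // 0 ≤ k ∧ k ≤ 2 ^ R - i} =>
      Set.indicator (Set.Icc (0 : ℝ) 1) (fold (scaled φ R k)))
      (i := ⟨k, by omega, by rcases hi with rfl | rfl <;> omega⟩)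
      (by simpa only [indicator_fold_of_support hs] using hm)
    simp only [indicator_fold_of_support hs] at this
    exact this
  · lift k to ℕ using by omega
    have h3 : k + p < 2 ^ R := by
      zify
      omega
    have h4 : boundaryScaled φ p R k = scaled φ R k := by
      rw [boundaryScaled, if_neg (by omega), if_pos (by omega)]
    have h5 : Set.indicator (Set.Icc (0 : ℝ) 1) (boundaryScaled φ p R k) = scaled φ R k := by
      rw [h4, Set.indicator_eq_self]
      exact hs.trans Set.Ioo_subset_Icc_self
    have := funMem_funSpan (u := fun k : {k : ℕ // k < 2 ^ R} =>
      Set.indicator (Set.Icc (0 : ℝ) 1) (boundaryScaled φ p R k))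
      (i := ⟨k, by omega⟩) (by simpa only [h5] using hm)
    simp only [h5] at this
    exact this

/-! ### Fourier transforms of combinations of translates, and the concentrated test function. -/

theorem fourier_dilate (G : ℝ → ℂ) (j : ℕ) (w : ℝ) :
    𝓕 (dilate j G) w = ((2 ^ j : ℝ)⁻¹ * Real.sqrt (2 ^ j) : ℝ) * 𝓕 G (w / 2 ^ j) := by
  have ha : (0 : ℝ) < 2 ^ j := by positivity
  rw [Real.fourier_real_eq_integral_exp_smul, Real.fourier_real_eq_integral_exp_smul]
  have h := Measure.integral_comp_mul_left
    (fun y : ℝ => cexp ((-2 * Real.pi * y * (w / 2 ^ j) : ℝ) * I) • ((Real.sqrt (2 ^ j) : ℂ) * G y))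
    (2 ^ j)
  have h1 : ∀ v : ℝ, cexp ((-2 * Real.pi * (2 ^ j * v) * (w / 2 ^ j) : ℝ) * I)
      • ((Real.sqrt (2 ^ j) : ℂ) * G (2 ^ j * v))
      = cexp ((-2 * Real.pi * v * w : ℝ) * I) • dilate j G v := by
    intro v
    have : -2 * Real.pi * (2 ^ j * v) * (w / 2 ^ j) = -2 * Real.pi * v * w := by
      field_simp
    rw [this, dilate]
  simp only [h1] at h
  rw [h, abs_of_pos (by positivity)]
  simp only [smul_eq_mul, real_smul]
  rw [Complex.ofReal_mul, mul_assoc, ← integral_const_mul ((Real.sqrt (2 ^ j) : ℝ) : ℂ)]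
  congr 2
  ext y
  ring

theorem fourier_comp_sub (φ : ℝ → ℂ) (c ξ : ℝ) :
    ∫ v : ℝ, cexp ((-2 * Real.pi * v * ξ : ℝ) * I) • φ (v - c)
      = cexp ((-2 * Real.pi * c * ξ : ℝ) * I) * 𝓕 φ ξ := by
  rw [Real.fourier_real_eq_integral_exp_smul, ← integral_const_mul,
    ← integral_sub_right_eq_self (fun x : ℝ => cexp ((-2 * Real.pi * c * ξ : ℝ) * I)
      * cexp ((-2 * Real.pi * x * ξ : ℝ) * I) • φ x) c]
  refine integral_congr_ae (Filter.Eventually.of_forall fun v => ?_)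
  simp only [smul_eq_mul]
  rw [← mul_assoc, ← Complex.exp_add]
  congr 2
  push_cast
  ring

theorem fourier_sum_translates {φ : ℝ → ℂ} (hφ : Integrable φ volume) (a : ℕ → ℂ) (M : ℕ) (p ξ : ℝ) :
    𝓕 (fun y => ∑ k ∈ Finset.range M, a k * φ (y - (p + k))) ξ
      = cexp ((-2 * Real.pi * p * ξ : ℝ) * I)
        * (∑ k ∈ Finset.range M, a k * cexp ((-2 * Real.pi * ξ : ℝ) * I) ^ k) * 𝓕 φ ξ := by
  rw [Real.fourier_real_eq_integral_exp_smul]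
  simp only [smul_eq_mul, Finset.mul_sum, Finset.sum_mul]
  rw [integral_finsetSum]
  · refine Finset.sum_congr rfl fun k _ => ?_
    have h := fourier_comp_sub φ (p + k) ξ
    simp only [smul_eq_mul] at h
    have h1 : ∀ v : ℝ, cexp ((-2 * Real.pi * v * ξ : ℝ) * I) * (a k * φ (v - (p + k)))
        = a k * (cexp ((-2 * Real.pi * v * ξ : ℝ) * I) * φ (v - (p + k))) := fun v => by ring
    simp only [h1]
    rw [integral_const_mul, h, ← Complex.exp_nat_mul]
    have h2 : cexp ((-2 * Real.pi * (p + k) * ξ : ℝ) * I)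
        = cexp ((-2 * Real.pi * p * ξ : ℝ) * I) * cexp (k * ((-2 * Real.pi * ξ : ℝ) * I)) := by
      rw [← Complex.exp_add]
      congr 1
      push_cast
      ring
    rw [h2]
    ring
  · intro k _
    refine Integrable.bdd_mul (c := 1) ((hφ.comp_sub_right _).const_mul _)
      (Continuous.aestronglyMeasurable (by fun_prop)) (Filter.Eventually.of_forall fun v => ?_)
    rw [norm_exp_ofReal_mul_I]

theorem norm_fourier_le_integral_norm (φ : ℝ → ℂ) (ξ : ℝ) : ‖𝓕 φ ξ‖ ≤ ∫ x, ‖φ x‖ := by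
  rw [Real.fourier_real_eq_integral_exp_smul]
  refine (norm_integral_le_integral_norm _).trans (le_of_eq ?_)
  simp only [norm_smul, norm_exp_ofReal_mul_I, one_mul]

theorem IsWaveletSpace.exists_concentrated {φ : ℝ → ℂ} {d : ℝ} (hd : 0 < d)
    (hφ : HasLowerRieszBound φ d) {p : ℕ}
    (hsupp : Function.support φ ⊆ Set.Icc (-(p : ℝ) + 1) p) {R : ℕ} {T : Submodule ℂ L2R}
    (hT : IsWaveletSpace φ p R T) {n : ℕ} (hn : 2 * n + 1 + 2 * p ≤ 2 ^ R) {z : ℝ}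
    (hz : 1 / 2 ≤ z) (hz1 : z ≤ 1) :
    ∃ f ∈ T, f ≠ 0 ∧ ∀ x : ℝ, 2 * |x| ≤ z * 2 ^ R →
      ‖𝓕 (f : ℝ → ℂ) x‖ ^ 2
        ≤ ((∫ x, ‖φ x‖) + 1) ^ 2 / (d * Real.cosh (n * (1 - z)) ^ 2) * ‖f‖ ^ 2 := by
  obtain ⟨Q, hQ1, hQ2, hQ3⟩ := exists_polynomial_small_on_arc n hz hz1
  have hint : Integrable φ volume := by
    rw [← integrableOn_iff_integrable_of_support_subset hsupp]
    have : MemLp φ 2 (volume.restrict (Set.Icc (-(p : ℝ) + 1) p)) := hφ.memLp.restrict _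
    exact this.integrable (by norm_num)
  set M := 2 * n + 1 with hM
  set G : ℝ → ℂ := fun y => ∑ k ∈ Finset.range M, Q.coeff k * φ (y - (p + k)) with hG
  have hpow : (0 : ℝ) < 2 ^ R := by positivity
  have hn' : (2 * n + 1 + 2 * p : ℤ) ≤ 2 ^ R := by exact_mod_cast hn
  have hmem : FunMem T (dilate R G) := by
    have h := FunMem.sum_mul (s := Finset.range M) (u := fun k => scaled φ R ((p + k : ℕ) : ℤ))
      (fun k hk => hT.funMem_scaled hφ.memLp hsupp (by push_cast; omega)
        (by have := Finset.mem_range.1 hk; push_cast; omega)) Q.coeff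
    convert h using 1
    ext x
    simp only [dilate, hG, scaled, Finset.mul_sum]
    refine Finset.sum_congr rfl fun k _ => ?_
    push_cast
    ring
  obtain ⟨f, hfT, hf⟩ := hmem
  have hGm : MemLp G 2 volume := memLp_finsetSum _ fun k _ =>
    (MemLp.comp_sub_const hφ.memLp _).const_mul _
  have hnorm : d * ∑ k ∈ Finset.range M, ‖Q.coeff k‖ ^ 2 ≤ ‖f‖ ^ 2 := by
    rw [Lp.norm_def, eLpNorm_congr_ae hf, eLpNorm_dilate hGm.1]
    have hinj : Set.InjOn (fun k : ℕ => (p + k : ℤ)) (Finset.range M) := fun a _ b _ h => by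
      simpa using h
    -- The Riesz bound takes coefficients indexed by `ℤ`: the translate by `p + k` carries
    -- coefficient `k` of `Q`.
    have h := hφ.le ((Finset.range M).image fun k : ℕ => (p + k : ℤ)) (fun k => Q.coeff (k - p).toNat)
    simp only [Finset.sum_image hinj, add_sub_cancel_left, Int.toNat_natCast] at h
    push_cast at h
    exact h
  have hcosh := Real.cosh_pos (n * (1 - z))
  set S := ∑ k ∈ Finset.range M, ‖Q.coeff k‖ ^ 2 with hS
  have hM' : ((M : ℕ) : ℝ) ≤ 2 ^ R := by
    have : M ≤ 2 ^ R := by omega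
    exact_mod_cast this
  have hS0 : 0 ≤ S := Finset.sum_nonneg fun _ _ => sq_nonneg _
  -- The Cauchy–Schwarz loss `2n+1` is at most `2^R`, and so is compensated by the factor `2^{-R}`
  -- that dilation puts on the squared Fourier transform.
  have hS1 : Real.cosh (n * (1 - z)) ^ 2 ≤ 2 ^ R * S := by
    refine hQ2.trans (mul_le_mul_of_nonneg_right ?_ hS0)
    rw [hM] at hM'
    push_cast at hM'
    exact hM'
  have hSpos : 0 < S := by
    by_contra! h
    have h1 : S = 0 := le_antisymm h hS0
    rw [h1, mul_zero] at hS1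
    nlinarith
  refine ⟨f, hfT, ?_, fun x hx => ?_⟩
  · rintro rfl
    rw [norm_zero] at hnorm
    nlinarith [mul_pos hd hSpos]
  · have hF : 𝓕 (f : ℝ → ℂ) x = 𝓕 (dilate R G) x := by
      rw [Real.fourier_real_eq_integral_exp_smul, Real.fourier_real_eq_integral_exp_smul]
      refine integral_congr_ae ?_
      filter_upwards [hf] with y hy
      rw [hy]
    set L := ∫ x, ‖φ x‖ with hL
    have hL0 : 0 ≤ L := integral_nonneg fun _ => norm_nonneg _
    have hQx : ‖∑ k ∈ Finset.range M, Q.coeff k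
        * cexp ((-2 * Real.pi * (x / 2 ^ R) : ℝ) * I) ^ k‖ ≤ 1 := by
      rw [← Polynomial.eval_eq_sum_range' hQ3]
      refine hQ1 _ ?_
      rw [abs_mul, abs_mul, abs_div, abs_of_pos Real.pi_pos, abs_of_pos hpow, abs_neg, abs_two]
      calc 2 * Real.pi * (|x| / 2 ^ R) = Real.pi * (2 * |x| / 2 ^ R) := by ring
        _ ≤ Real.pi * z := by
          refine mul_le_mul_of_nonneg_left ?_ Real.pi_pos.le
          rwa [div_le_iff₀ hpow]
    have hGF : ‖𝓕 G (x / 2 ^ R)‖ ≤ L := by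
      rw [hG, fourier_sum_translates hint, norm_mul, norm_mul, norm_exp_ofReal_mul_I, one_mul]
      calc _ ≤ 1 * L := mul_le_mul hQx (norm_fourier_le_integral_norm φ _) (norm_nonneg _) zero_le_one
        _ = L := one_mul L
    have h1 : ‖𝓕 (f : ℝ → ℂ) x‖ ^ 2 ≤ (2 ^ R)⁻¹ * L ^ 2 := by
      rw [hF, fourier_dilate, norm_mul, mul_pow, Complex.norm_real, Real.norm_eq_abs, sq_abs, mul_pow,
        Real.sq_sqrt hpow.le]
      have h2 : ((2 ^ R : ℝ)⁻¹) ^ 2 * 2 ^ R = (2 ^ R)⁻¹ := by field_simp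
      rw [h2]
      exact mul_le_mul_of_nonneg_left (pow_le_pow_left₀ (norm_nonneg _) hGF 2) (by positivity)
    refine h1.trans ?_
    rw [div_mul_eq_mul_div, le_div_iff₀ (by positivity), inv_mul_eq_div, div_mul_eq_mul_div,
      div_le_iff₀ hpow]
    have h3 : d * Real.cosh (n * (1 - z)) ^ 2 ≤ ‖f‖ ^ 2 * 2 ^ R := by
      calc d * Real.cosh (n * (1 - z)) ^ 2 ≤ d * (2 ^ R * S) :=
            mul_le_mul_of_nonneg_left hS1 hd.le
        _ = d * S * 2 ^ R := by ring
        _ ≤ _ := mul_le_mul_of_nonneg_right hnorm hpow.le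
    rw [mul_assoc]
    exact mul_le_mul (by gcongr; linarith) h3 (by positivity) (by positivity)

/-! ### Sums of translates and nontriviality of the wavelet spaces. -/

/-- The sum of all translates of `g` by multiples of `m`. -/
noncomputable def translateSum (g : ℝ → ℂ) (m x : ℝ) : ℂ := ∑' l : ℤ, g (x - m * l)

theorem eq_zero_of_support_subset {g : ℝ → ℂ} {A : ℝ} (hg : Function.support g ⊆ Set.Icc (-A) A)
    {x : ℝ} (hx : A < |x|) : g x = 0 := by
  by_contra h
  exact absurd (abs_le.2 (hg h)) (not_le.2 hx)

theorem eq_zero_of_notMem_Icc {g : ℝ → ℂ} {A c m x : ℝ}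
    (hg : Function.support g ⊆ Set.Icc (-A) A) (hm : 0 < m) (hx : |x| ≤ c) {L : ℕ}
    (hL : A + c ≤ m * L) {l : ℤ} (hl : l ∉ Finset.Icc (-(L : ℤ)) L) : g (x - m * l) = 0 := by
  refine eq_zero_of_support_subset hg ?_
  have h1 : (L : ℤ) < |l| := by
    by_contra! h
    exact hl (Finset.mem_Icc.2 (abs_le.1 h))
  have h2 : (L : ℝ) < |(l : ℝ)| := by exact_mod_cast h1
  have h3 : |m * l| ≤ |x - m * l| + |x| := by
    rw [abs_sub_comm]
    simpa using abs_add_le (m * l - x) x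
  rw [abs_mul, abs_of_pos hm] at h3
  nlinarith

theorem translateSum_eq_sum {g : ℝ → ℂ} {A c m x : ℝ}
    (hg : Function.support g ⊆ Set.Icc (-A) A) (hm : 0 < m) (hx : |x| ≤ c) {L : ℕ}
    (hL : A + c ≤ m * L) :
    translateSum g m x = ∑ l ∈ Finset.Icc (-(L : ℤ)) L, g (x - m * l) :=
  tsum_eq_sum fun _ hl => eq_zero_of_notMem_Icc hg hm hx hL hl

theorem exists_nat_mul_ge (c : ℝ) {m : ℝ} (hm : 0 < m) : ∃ L : ℕ, c ≤ m * L := by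
  obtain ⟨L, hL⟩ := exists_nat_ge (c / m)
  exact ⟨L, by rwa [div_le_iff₀' hm] at hL⟩

theorem summable_translates {g : ℝ → ℂ} {A m : ℝ} (hg : Function.support g ⊆ Set.Icc (-A) A)
    (hm : 0 < m) (x : ℝ) : Summable fun l : ℤ => g (x - m * l) := by
  obtain ⟨L, hL⟩ := exists_nat_mul_ge (A + |x|) hm
  exact summable_of_ne_finset_zero fun l hl => eq_zero_of_notMem_Icc hg hm le_rfl hL hl

theorem translateSum_sub_period (g : ℝ → ℂ) (m x : ℝ) :
    translateSum g m (x - m) = translateSum g m x := by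
  rw [translateSum, translateSum, ← (Equiv.addRight (1 : ℤ)).tsum_eq fun l : ℤ => g (x - m * l)]
  refine tsum_congr fun l => ?_
  simp only [Equiv.coe_addRight]
  push_cast
  congr 1
  ring

theorem memLp_indicator_translateSum {g : ℝ → ℂ} (hg2 : MemLp g 2 volume) {A m : ℝ}
    (hg : Function.support g ⊆ Set.Icc (-A) A) (hm : 0 < m) :
    MemLp (Set.indicator (Set.Icc (-1 : ℝ) 1) (translateSum g m)) 2 volume := by
  obtain ⟨L, hL⟩ := exists_nat_mul_ge (A + 1) hm
  have h : Set.indicator (Set.Icc (-1 : ℝ) 1) (translateSum g m) = Set.indicator (Set.Icc (-1 : ℝ) 1)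
      fun x => ∑ l ∈ Finset.Icc (-(L : ℤ)) L, g (x - m * l) :=
    Set.indicator_congr fun x hx => translateSum_eq_sum hg hm (abs_le.2 hx) hL
  rw [h]
  exact (memLp_finsetSum _ fun l _ => MemLp.comp_sub_const hg2 _).indicator measurableSet_Icc

/-- The one-sided sum `ψ = ∑_{j ≥ 0} θ(· - mj)` vanishes to the left of the support of `θ`, and to
the right it equals the full sum, which is zero. So `ψ` is in `L²`, and the partial sums telescope
to `ψ - ψ(· - mN)`, of norm at most `2‖ψ‖`. -/
theorem exists_eLpNorm_sum_le {θ : ℝ → ℂ} (hθ : MemLp θ 2 volume) {A m : ℝ} (hm : 0 < m)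
    (hsupp : Function.support θ ⊆ Set.Icc (-A) A) (h0 : ∀ᵐ y ∂volume, translateSum θ m y = 0) :
    ∃ C : ℝ, ∀ N : ℕ,
      (eLpNorm (fun y => ∑ j ∈ Finset.range N, θ (y - m * j)) 2 volume).toReal ≤ C := by
  set ψ : ℝ → ℂ := fun y => ∑' j : ℕ, θ (y - m * j) with hψ
  have hsum : ∀ y, Summable fun j : ℕ => θ (y - m * j) := fun y => by
    have h := (summable_translates hsupp hm y).comp_injective Nat.cast_injective
    simpa [Function.comp_def] using h
  obtain ⟨J, hJ⟩ := exists_nat_mul_ge (A + A) hm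
  have hψm : MemLp ψ 2 volume := by
    have h1 : MemLp (Set.indicator (Set.Icc (-A) A)
        fun y => ∑ j ∈ Finset.range (J + 1), θ (y - m * j)) 2 volume :=
      (memLp_finsetSum _ fun l _ => MemLp.comp_sub_const hθ _).indicator measurableSet_Icc
    refine (memLp_congr_ae ?_).1 h1
    filter_upwards [h0] with y hy
    by_cases hyA : y ∈ Set.Icc (-A) A
    · rw [Set.indicator_of_mem hyA]
      refine (tsum_eq_sum fun j hj => ?_).symm
      have h2 : J + 1 ≤ j := by simpa using hj
      have h3 : (J : ℝ) + 1 ≤ j := by exact_mod_cast h2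
      by_contra hne
      have := (hsupp hne).1
      nlinarith [hyA.2]
    · rw [Set.indicator_of_notMem hyA]
      rcases lt_or_ge A y with h2 | h2
      · rw [← hy, translateSum]
        have h3 := Function.Injective.tsum_eq (g := ((↑) : ℕ → ℤ)) Nat.cast_injective
          (f := fun l : ℤ => θ (y - m * l)) (by
            intro l hl
            have h4 := (hsupp hl).2
            have h5 : 0 ≤ l := by
              by_contra! h6
              have h7 : (l : ℝ) < 0 := by exact_mod_cast h6
              nlinarith
            exact ⟨l.toNat, by simp [h5]⟩)
        rw [← h3]
        simp [hψ]
      · have h3 : y < -A := by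
          by_contra! h4
          exact hyA ⟨h4, h2⟩
        have h5 : ∀ j : ℕ, θ (y - m * j) = 0 := fun j => by
          by_contra hne
          have h6 := (hsupp hne).1
          have h7 : 0 ≤ m * j := by positivity
          linarith
        simp [hψ, h5]
  refine ⟨(eLpNorm ψ 2 volume + eLpNorm ψ 2 volume).toReal, fun N => ?_⟩
  have hF : (fun y => ∑ j ∈ Finset.range N, θ (y - m * j)) = ψ - fun y => ψ (y - m * N) := by
    ext y
    have h1 := (hsum y).sum_add_tsum_nat_add N
    rw [Pi.sub_apply]
    change _ = (∑' j : ℕ, θ (y - m * j)) - ∑' j : ℕ, θ (y - m * N - m * j)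
    rw [← h1, eq_sub_iff_add_eq]
    congr 1
    refine tsum_congr fun j => ?_
    push_cast
    congr 1
    ring
  rw [hF]
  refine ENNReal.toReal_mono (ENNReal.add_ne_top.2 ⟨hψm.2.ne, hψm.2.ne⟩) ?_
  refine (eLpNorm_sub_le hψm.1 (MemLp.comp_sub_const hψm _).1 (by norm_num)).trans (le_of_eq ?_)
  rw [eLpNorm_comp_sub_const hψm]

/-- Otherwise `θ = φ - φ(· - c)` has vanishing sum of translates, so `∑_{j<N} θ(· - mj)` stays
bounded in `L²`. As `m ∤ c`, no two translates of `φ` in it coincide, and the lower Riesz bound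
forces the squared norm to grow at least like `dN`. -/
theorem translateSum_not_periodic {φ : ℝ → ℂ} {d : ℝ} (hd : 0 < d) (hφ : HasLowerRieszBound φ d)
    {A : ℝ} (hA : Function.support φ ⊆ Set.Icc (-A) A) {m c : ℕ} (hm : 0 < m) (hc : ¬ m ∣ c) :
    ¬ ∀ᵐ y ∂volume, translateSum φ m y = translateSum φ m (y - c) := by
  intro h
  have hm' : (0 : ℝ) < m := by exact_mod_cast hm
  set θ : ℝ → ℂ := fun y => φ y - φ (y - c) with hθ
  have hθm : MemLp θ 2 volume := hφ.memLp.sub (MemLp.comp_sub_const hφ.memLp _)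
  have hθs : Function.support θ ⊆ Set.Icc (-(A + c)) (A + c) := by
    intro y hy
    have hc0 : (0 : ℝ) ≤ c := by positivity
    by_cases h1 : φ y = 0
    · have h2 : φ (y - c) ≠ 0 := fun h2 => hy (by simp [hθ, h1, h2])
      have := hA h2
      exact ⟨by linarith [this.1], by linarith [this.2]⟩
    · have := hA h1
      exact ⟨by linarith [this.1], by linarith [this.2]⟩
  have hθ0 : ∀ᵐ y ∂volume, translateSum θ m y = 0 := by
    filter_upwards [h] with y hy
    rw [← sub_eq_zero] at hy
    rw [← hy, translateSum, translateSum, translateSum,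
      ← (summable_translates hA hm' y).tsum_sub (summable_translates hA hm' _)]
    refine tsum_congr fun l => ?_
    simp only [hθ]
    congr 2
    ring
  obtain ⟨C, hC⟩ := exists_eLpNorm_sum_le hθm hm' hθs hθ0
  obtain ⟨N, hN⟩ := exists_nat_gt (C ^ 2 / d)
  have hcm : ¬ (m : ℤ) ∣ c := by exact_mod_cast hc
  set β : ℤ → ℂ := fun k => if (m : ℤ) ∣ k then 1 else -1 with hβ
  set s₁ := (Finset.range N).image fun j : ℕ => (m * j : ℤ) with hs₁
  set s₂ := (Finset.range N).image fun j : ℕ => (m * j + c : ℤ) with hs₂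
  have hm0 : (m : ℤ) ≠ 0 := by exact_mod_cast hm.ne'
  have hi₁ : Set.InjOn (fun j : ℕ => (m * j : ℤ)) (Finset.range N) := fun a _ b _ h => by
    simpa [hm.ne'] using h
  have hi₂ : Set.InjOn (fun j : ℕ => (m * j + c : ℤ)) (Finset.range N) := fun a _ b _ h => by
    simpa [hm.ne'] using h
  have hdvd : ∀ j : ℕ, ¬ (m : ℤ) ∣ m * j + c := fun j hj =>
    hcm ((Int.dvd_add_right (dvd_mul_right _ _)).1 hj)
  have hdisj : Disjoint s₁ s₂ := by
    rw [Finset.disjoint_left]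
    intro k h1 h2
    obtain ⟨i, -, rfl⟩ := Finset.mem_image.1 h1
    obtain ⟨j, -, hj⟩ := Finset.mem_image.1 h2
    exact hdvd j (hj ▸ dvd_mul_right _ _)
  have hle := hφ.le (s₁ ∪ s₂) β
  have hleft : (N : ℝ) ≤ ∑ k ∈ s₁ ∪ s₂, ‖β k‖ ^ 2 := by
    rw [Finset.sum_union hdisj, hs₁, hs₂, Finset.sum_image hi₁, Finset.sum_image hi₂]
    simp [hβ, hdvd]
  have hfun : (fun x : ℝ => ∑ k ∈ s₁ ∪ s₂, β k * φ (x - k))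
      = fun y => ∑ j ∈ Finset.range N, θ (y - m * j) := by
    ext x
    rw [Finset.sum_union hdisj, hs₁, hs₂, Finset.sum_image hi₁, Finset.sum_image hi₂,
      ← Finset.sum_add_distrib]
    refine Finset.sum_congr rfl fun j _ => ?_
    simp only [hβ, hdvd, dvd_mul_right, if_true, if_false, hθ]
    push_cast
    rw [sub_sub x]
    ring
  rw [hfun] at hle
  have h1 := pow_le_pow_left₀ ENNReal.toReal_nonneg (hC N) 2
  rw [div_lt_iff₀ hd] at hN
  nlinarith

theorem exists_mem_funSpan_ne_zero {ι : Type} {u : ι → ℝ → ℂ} {i : ι} (h : MemLp (u i) 2 volume)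
    (h0 : ¬ u i =ᵐ[volume] 0) : ∃ f ∈ funSpan u, f ≠ 0 := by
  refine ⟨h.toLp _, Submodule.subset_span ⟨i, h.coeFn_toLp⟩, fun h1 => h0 ?_⟩
  have h2 := h.coeFn_toLp
  rw [h1] at h2
  exact h2.symm.trans (Lp.coeFn_zero ℂ 2 volume)

theorem ae_comp_mul {P : ℝ → Prop} (h : ∀ᵐ x ∂(volume : Measure ℝ), P x) {a : ℝ} (ha : a ≠ 0) :
    ∀ᵐ x ∂(volume : Measure ℝ), P (a * x) := by
  have hq : Measure.QuasiMeasurePreserving (fun x : ℝ => a * x) volume volume := by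
    refine ⟨by fun_prop, ?_⟩
    rw [Real.map_volume_mul_left ha]
    exact Measure.smul_absolutelyContinuous
  exact hq.ae h

theorem ae_comp_sub {P : ℝ → Prop} (h : ∀ᵐ x ∂(volume : Measure ℝ), P x) (a : ℝ) :
    ∀ᵐ x ∂(volume : Measure ℝ), P (x - a) :=
  (measurePreserving_sub_right volume a).quasiMeasurePreserving.ae h

theorem ae_comp_const_sub {P : ℝ → Prop} (h : ∀ᵐ x ∂(volume : Measure ℝ), P x) (a : ℝ) :
    ∀ᵐ x ∂(volume : Measure ℝ), P (a - x) :=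
  (Measure.measurePreserving_sub_left volume a).quasiMeasurePreserving.ae h

/-- A periodic function that vanishes on a period vanishes. -/
theorem ae_eq_zero_of_periodic {G : ℝ → ℂ} {m : ℝ} (hm : 0 < m) (hG : ∀ x, G (x - m) = G x)
    (h : ∀ᵐ x ∂volume, x ∈ Set.Icc 0 m → G x = 0) : ∀ᵐ x ∂volume, G x = 0 := by
  have hper : Function.Periodic G m := fun x => by rw [← hG (x + m), add_sub_cancel_right]
  have h1 : ∀ᵐ x ∂(volume : Measure ℝ), ∀ n : ℤ, x - n * m ∈ Set.Icc 0 m → G (x - n * m) = 0 :=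
    ae_all_iff.2 fun n => ae_comp_sub h (n * m)
  filter_upwards [h1] with x hx
  rw [← hper.sub_int_mul_eq ⌊x / m⌋]
  refine hx _ ⟨?_, ?_⟩
  · have := Int.floor_le (x / m)
    rw [le_div_iff₀ hm] at this
    linarith
  · have := Int.lt_floor_add_one (x / m)
    rw [div_lt_iff₀ hm] at this
    linarith

/-- An even function with period `2 a` that vanishes on `[0, a]` vanishes. -/
theorem ae_eq_zero_of_even_of_periodic {G : ℝ → ℂ} {a : ℝ} (ha : 0 < a)
    (hG : ∀ x, G (x - 2 * a) = G x) (he : ∀ x, G (-x) = G x)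
    (h : ∀ᵐ x ∂volume, x ∈ Set.Icc 0 a → G x = 0) : ∀ᵐ x ∂volume, G x = 0 := by
  refine ae_eq_zero_of_periodic (by positivity) hG ?_
  filter_upwards [h, ae_comp_const_sub h (2 * a)] with x hx hx' hm
  rcases le_total x a with h1 | h1
  · exact hx ⟨hm.1, h1⟩
  · have h2 := hx' ⟨by linarith [hm.2], by linarith⟩
    rwa [← he, neg_sub, hG] at h2

/-- Rescaling of functions that vanish on `[0,1]`. -/
theorem ae_eq_zero_of_indicator_comp_mul {F : ℝ → ℂ} {j : ℕ}
    (h : Set.indicator (Set.Icc (0 : ℝ) 1) (fun x => (Real.sqrt (2 ^ j) : ℂ) * F (2 ^ j * x))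
      =ᵐ[volume] 0) :
    ∀ᵐ y ∂volume, y ∈ Set.Icc (0 : ℝ) (2 ^ j) → F y = 0 := by
  have ha : (0 : ℝ) < 2 ^ j := by positivity
  filter_upwards [ae_comp_mul h (inv_ne_zero ha.ne')] with y hy hm
  have h1 : (2 ^ j : ℝ)⁻¹ * y ∈ Set.Icc (0 : ℝ) 1 := by
    rw [inv_mul_eq_div]
    exact ⟨div_nonneg hm.1 ha.le, (div_le_one ha).2 hm.2⟩
  rw [Set.indicator_of_mem h1, mul_inv_cancel_left₀ ha.ne', Pi.zero_apply] at hy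
  have h2 : (Real.sqrt (2 ^ j) : ℂ) ≠ 0 := by
    rw [Ne, Complex.ofReal_eq_zero]
    exact (Real.sqrt_pos.2 ha).ne'
  exact (mul_eq_zero.1 hy).resolve_left h2

theorem translateSum_scaled (φ : ℝ → ℂ) (j : ℕ) (k : ℤ) (m x : ℝ) :
    translateSum (scaled φ j k) m x
      = (Real.sqrt (2 ^ j) : ℂ) * translateSum φ (m * 2 ^ j) (2 ^ j * x - k) := by
  simp only [translateSum, scaled, dilate]
  rw [tsum_mul_left]
  congr 1
  refine tsum_congr fun l => ?_
  congr 1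
  ring

theorem periodize_eq_translateSum (f : ℝ → ℂ) (x : ℝ) : periodize f x = translateSum f 1 x := by
  rw [periodize, translateSum, ← (Equiv.neg ℤ).tsum_eq]
  refine tsum_congr fun l => ?_
  simp [sub_eq_add_neg]

theorem fold_eq_translateSum (f : ℝ → ℂ) (x : ℝ) :
    fold f x = translateSum f 2 x + translateSum f 2 (-x) := by
  rw [fold, translateSum, translateSum, ← (Equiv.neg ℤ).tsum_eq fun l : ℤ => f (2 * l - x)]
  congr 1
  refine tsum_congr fun l => ?_
  congr 1
  simp only [Equiv.neg_apply]
  push_cast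
  ring

theorem support_scaled_subset_Icc {φ : ℝ → ℂ} {A : ℝ} (hA : Function.support φ ⊆ Set.Icc (-A) A)
    (j : ℕ) (k : ℤ) : Function.support (scaled φ j k) ⊆ Set.Icc (-(A + |(k : ℝ)|)) (A + |(k : ℝ)|) := by
  intro x hx
  have h1 := hA (right_ne_zero_of_mul hx : φ (2 ^ j * x - k) ≠ 0)
  have h2 : (1 : ℝ) ≤ 2 ^ j := one_le_pow₀ (by norm_num)
  rw [Set.mem_Icc, ← abs_le] at h1 ⊢
  have h3 : |2 ^ j * x| ≤ |2 ^ j * x - k| + |(k : ℝ)| := by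
    simpa using abs_add_le (2 ^ j * x - k) (k : ℝ)
  rw [abs_mul, abs_of_pos (by positivity : (0 : ℝ) < 2 ^ j)] at h3
  nlinarith [abs_nonneg x]

section nontrivial

variable {φ : ℝ → ℂ} {d : ℝ} {p R : ℕ}

theorem support_subset_symmetric (hsupp : Function.support φ ⊆ Set.Icc (-(p : ℝ) + 1) p) :
    Function.support φ ⊆ Set.Icc (-(p : ℝ)) p :=
  hsupp.trans (Set.Icc_subset_Icc (by linarith) le_rfl)

theorem memLp_indicator_translateSum_scaled (hφ : MemLp φ 2 volume) {A : ℝ}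
    (hA : Function.support φ ⊆ Set.Icc (-A) A) (j : ℕ) (k : ℤ) {m : ℝ} (hm : 0 < m) :
    MemLp (Set.indicator (Set.Icc (-1 : ℝ) 1) (translateSum (scaled φ j k) m)) 2 volume :=
  memLp_indicator_translateSum (memLp_scaled hφ j k) (support_scaled_subset_Icc hA j k) hm

/-- If the generator `k = 0` vanished, the sum of translates of `φ` by multiples of `2^R` would be
zero, hence `1`-periodic, although `2^R ∤ 1`. -/
theorem exists_mem_periodicSpace_ne_zero (hd : 0 < d) (hφ : HasLowerRieszBound φ d) {A : ℝ}
    (hA : Function.support φ ⊆ Set.Icc (-A) A) (hR : 1 ≤ R) : ∃ f ∈ periodicSpace φ R, f ≠ 0 := by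
  have h2R : (2 : ℤ) ≤ 2 ^ R := by
    calc (2 : ℤ) = 2 ^ 1 := by norm_num
      _ ≤ 2 ^ R := pow_le_pow_right₀ (by norm_num) hR
  have hfun : ∀ k : ℤ, Set.indicator (Set.Icc (0 : ℝ) 1) (periodize (scaled φ R k))
      = Set.indicator (Set.Icc (0 : ℝ) 1)
        (Set.indicator (Set.Icc (-1 : ℝ) 1) (translateSum (scaled φ R k) 1)) := by
    intro k
    rw [Set.indicator_indicator, Set.inter_eq_left.2 (Set.Icc_subset_Icc (by norm_num) le_rfl)]
    congr 1
    ext x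
    exact periodize_eq_translateSum _ x
  refine exists_mem_funSpan_ne_zero (i := ⟨0, by omega, by omega⟩) ?_ ?_
  · rw [hfun]
    exact (memLp_indicator_translateSum_scaled hφ.memLp hA R 0 one_pos).indicator measurableSet_Icc
  · intro h
    have h1 : Set.indicator (Set.Icc (0 : ℝ) 1)
        (fun x => (Real.sqrt (2 ^ R) : ℂ) * translateSum φ (2 ^ R : ℕ) (2 ^ R * x)) =ᵐ[volume] 0 := by
      convert h using 2
      ext x
      rw [periodize_eq_translateSum, translateSum_scaled]
      simp
    have h2 := ae_eq_zero_of_indicator_comp_mul h1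
    have h3 := ae_eq_zero_of_periodic (m := (2 ^ R : ℕ)) (by positivity)
      (translateSum_sub_period φ _) (by push_cast at h2 ⊢; exact h2)
    refine translateSum_not_periodic hd hφ hA (m := 2 ^ R) (c := 1) (by positivity) ?_ ?_
    · intro hdvd
      have := Nat.le_of_dvd one_pos hdvd
      zify at this
      omega
    · filter_upwards [h3, ae_comp_sub h3 (1 : ℕ)] with y hy hy'
      rw [hy, hy']

/-- Write `F` for the sum of translates by multiples of `2·2^R`. If the generators `k = 0, 1`
vanish, then `F(y) + F(-y) = 0` and, after a shift by `1`, `F(y-2) + F(-y) = 0`. So `F` is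
`2`-periodic, although `2·2^R ∤ 2`. A single generator would not do, since `F` may be odd. -/
theorem exists_mem_foldedSpace_ne_zero (hd : 0 < d) (hφ : HasLowerRieszBound φ d) {A : ℝ}
    (hA : Function.support φ ⊆ Set.Icc (-A) A) (hR : 1 ≤ R) {i : ℤ} (hi : i = 0 ∨ i = 1) :
    ∃ f ∈ foldedSpace φ i R, f ≠ 0 := by
  have h2R : (2 : ℤ) ≤ 2 ^ R := by
    calc (2 : ℤ) = 2 ^ 1 := by norm_num
      _ ≤ 2 ^ R := pow_le_pow_right₀ (by norm_num) hR
  have ha : (0 : ℝ) < 2 ^ R := by positivity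
  have hfun : ∀ k : ℤ, Set.indicator (Set.Icc (0 : ℝ) 1) (fold (scaled φ R k))
      = Set.indicator (Set.Icc (0 : ℝ) 1) (fun x =>
        Set.indicator (Set.Icc (-1 : ℝ) 1) (translateSum (scaled φ R k) 2) x
        + Set.indicator (Set.Icc (-1 : ℝ) 1) (translateSum (scaled φ R k) 2) (-x)) := by
    intro k
    refine Set.indicator_congr fun x hx => ?_
    rw [fold_eq_translateSum, Set.indicator_of_mem (by constructor <;> linarith [hx.1, hx.2]),
      Set.indicator_of_mem (by constructor <;> linarith [hx.1, hx.2])]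
  by_contra! hcon
  have hzero : ∀ k : ℤ, 0 ≤ k → k ≤ 2 ^ R - i → ∀ᵐ y ∂volume,
      translateSum φ (2 * 2 ^ R) (y - k) + translateSum φ (2 * 2 ^ R) (-y - k) = 0 := by
    intro k hk1 hk2
    have h : Set.indicator (Set.Icc (0 : ℝ) 1) (fold (scaled φ R k)) =ᵐ[volume] 0 := by
      by_contra hne
      obtain ⟨f, hf, hf0⟩ := exists_mem_funSpan_ne_zero
        (u := fun k : {k : ℤ // 0 ≤ k ∧ k ≤ 2 ^ R - i} =>
          Set.indicator (Set.Icc (0 : ℝ) 1) (fold (scaled φ R k))) (i := ⟨k, hk1, hk2⟩) (by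
            simp only [hfun]
            have h1 := memLp_indicator_translateSum_scaled hφ.memLp hA R k (two_pos (α := ℝ))
            exact (h1.add (h1.comp_measurePreserving (Measure.measurePreserving_neg volume))).indicator
              measurableSet_Icc) hne
      exact hf0 (hcon f hf)
    refine ae_eq_zero_of_even_of_periodic (a := 2 ^ R) ha (fun y => ?_) (fun y => ?_) ?_
    · rw [sub_right_comm, translateSum_sub_period,
        ← translateSum_sub_period φ _ (-(y - 2 * 2 ^ R) - k)]
      congr 2
      ring
    · rw [neg_neg, add_comm]
    · refine ae_eq_zero_of_indicator_comp_mul (j := R)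
        (F := fun y => translateSum φ (2 * 2 ^ R) (y - k) + translateSum φ (2 * 2 ^ R) (-y - k)) ?_
      convert h using 2
      ext x
      rw [fold_eq_translateSum, translateSum_scaled, translateSum_scaled, mul_add]
      congr 3
      ring
  have hz0 := hzero 0 le_rfl (by omega)
  have hz1 := hzero 1 (by norm_num) (by omega)
  refine translateSum_not_periodic hd hφ hA (m := 2 * 2 ^ R) (c := 2) (by positivity) ?_ ?_
  · intro hdvd
    have := Nat.le_of_dvd two_pos hdvd
    zify at this
    omega
  · filter_upwards [hz0, ae_comp_sub hz1 1] with y hy hy'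
    push_cast at hy hy' ⊢
    rw [sub_zero, sub_zero] at hy
    have h1 : y - 1 - 1 = y - 2 := by ring
    have h2 : -(y - 1) - 1 = -y := by ring
    rw [h1, h2] at hy'
    linear_combination hy - hy'

theorem HasLowerRieszBound.not_ae_eq_zero (hd : 0 < d) (hφ : HasLowerRieszBound φ d) :
    ¬ φ =ᵐ[volume] 0 := by
  intro h
  have h1 := hφ.le {0} (fun _ => 1)
  simp only [Finset.sum_singleton, norm_one, one_pow, mul_one, Int.cast_zero, sub_zero, one_mul] at h1
  rw [eLpNorm_congr_ae h] at h1
  simp at h1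
  linarith

/-- The left edge function `k = 0` is a sum `W` of `2p-1` consecutive translates. If it vanished,
then `W(x) - W(x+1) = φ(x) - φ(x+2p-1)` would give `φ = 0` almost everywhere, since on the support
of `φ` the last term is zero except at one endpoint. -/
theorem exists_mem_boundarySpace_ne_zero (hd : 0 < d) (hφ : HasLowerRieszBound φ d)
    (hsupp : Function.support φ ⊆ Set.Icc (-(p : ℝ) + 1) p) (hR : 2 * p ≤ 2 ^ R) :
    ∃ f ∈ boundarySpace φ p R, f ≠ 0 := by
  have hp : 0 < p := by
    rcases Nat.eq_zero_or_pos p with rfl | h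
    · refine absurd (Filter.Eventually.of_forall fun x => ?_) (hφ.not_ae_eq_zero hd)
      by_contra hx
      have := hsupp hx
      simp only [Nat.cast_zero, Set.mem_Icc] at this
      linarith [this.1, this.2]
    · exact h
  have hR' : 2 * (p : ℝ) ≤ 2 ^ R := by exact_mod_cast hR
  have hb : boundaryScaled φ p R 0 = dilate R (leftEdge φ p 0) := by
    rw [boundaryScaled, if_pos hp]
  refine exists_mem_funSpan_ne_zero (i := ⟨0, by positivity⟩) ?_ ?_
  · simp only [hb]
    refine (MemLp.dilate ?_ R).indicator measurableSet_Icc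
    refine MemLp.indicator measurableSet_Ici (memLp_finsetSum _ fun n _ => MemLp.const_mul ?_ _)
    have := MemLp.comp_sub_const hφ.memLp (p - n - 1 : ℝ)
    convert this using 3
    ring
  · simp only [hb]
    intro h
    have h1 := ae_eq_zero_of_indicator_comp_mul h
    set W : ℝ → ℂ := fun x => ∑ n ∈ Finset.range (2 * p - 1), φ (x + n) with hW
    have h2 : ∀ᵐ (x : ℝ) ∂volume, x + p - 1 ∈ Set.Icc (0 : ℝ) (2 ^ R) → W x = 0 := by
      filter_upwards [ae_comp_sub h1 (1 - p)] with x hx hm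
      have h3 : x - (1 - p) = x + p - 1 := by ring
      rw [h3] at hx
      rw [← hx hm, leftEdge, Set.indicator_of_mem (Set.mem_Ici.2 hm.1)]
      have h4 : Finset.Icc 0 (2 * p - 2) = Finset.range (2 * p - 1) := by
        ext n
        simp only [Finset.mem_Icc, Finset.mem_range]
        omega
      rw [h4]
      refine Finset.sum_congr rfl fun n _ => ?_
      rw [Nat.choose_zero_right, Nat.cast_one, one_mul]
      congr 1
      ring
    refine hφ.not_ae_eq_zero hd ?_
    -- At `x = -p+1` the point `x + 2p - 1` equals `p`, where `φ` may be nonzero.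
    have hne : ∀ᵐ x ∂(volume : Measure ℝ), x ≠ -(p : ℝ) + 1 := by
      simp [ae_iff, measure_singleton]
    filter_upwards [h2, ae_comp_sub h2 (-1), hne] with x hx hx' hx1
    rw [Pi.zero_apply]
    by_contra hφx
    have hm := hsupp hφx
    have h3 : (-(p : ℝ) + 1) < x := lt_of_le_of_ne hm.1 (Ne.symm hx1)
    have hW0 := hx ⟨by linarith, by linarith [hm.2]⟩
    -- Here `x + p ≤ 2p` must not exceed `2^R`.
    have hW1 := hx' ⟨by linarith, by linarith [hm.2]⟩
    have hlast : φ (x + (2 * p - 1 : ℕ)) = 0 := by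
      by_contra h4
      have h5 := (hsupp h4).2
      rw [Nat.cast_sub (by omega)] at h5
      push_cast at h5
      linarith
    have h6 := Finset.sum_range_succ (fun n : ℕ => φ (x + n)) (2 * p - 1)
    rw [Finset.sum_range_succ'] at h6
    have h7 : ∑ k ∈ Finset.range (2 * p - 1), φ (x + (k + 1 : ℕ)) = W (x - -1) := by
      refine Finset.sum_congr rfl fun n _ => ?_
      push_cast
      congr 1
      ring
    rw [h7, hW1, hlast] at h6
    change _ = W x + 0 at h6
    rw [hW0] at h6
    simp only [Nat.cast_zero, add_zero, zero_add] at h6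
    exact hφx h6

theorem IsWaveletSpace.exists_mem_ne_zero {T : Submodule ℂ L2R} (hT : IsWaveletSpace φ p R T)
    (hd : 0 < d) (hφ : HasLowerRieszBound φ d)
    (hsupp : Function.support φ ⊆ Set.Icc (-(p : ℝ) + 1) p) (hR : 1 ≤ R) : ∃ f ∈ T, f ≠ 0 := by
  rcases hT with rfl | ⟨i, hi, rfl⟩ | ⟨hp, rfl⟩
  · exact exists_mem_periodicSpace_ne_zero hd hφ (support_subset_symmetric hsupp) hR
  · exact exists_mem_foldedSpace_ne_zero hd hφ (support_subset_symmetric hsupp) hR hi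
  · exact exists_mem_boundarySpace_ne_zero hd hφ hsupp hp

end nontrivial

/-! ### Choice of constants and the two ranges of `R`. -/

theorem theorem6p1 (φ : ℝ → ℂ) (hφ : IsScalingFunction φ)
    (p : ℕ) (hsupp : Function.support φ ⊆ Set.Icc (-(p : ℝ) + 1) p) :
    ∃ c₁ c₂ : ℝ, 0 < c₁ ∧ 0 < c₂ ∧
      ∀ (K : ℝ) (_ : 2 / Real.pi ^ 2 + 1 / 2 < K)
        (N : ℕ) (_ : 1 ≤ N) (ω : ℕ → ℝ) (_ : StrictMonoOn ω (Set.Icc 1 N))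
        (_ : ∀ n ∈ Set.Icc 1 N, ω n ∈ Set.Icc (-K) K)
        (R : ℕ) (_ : K < (2 : ℝ) ^ ((R : ℤ) - 1))
        (T : Submodule ℂ L2R) (_ : IsWaveletSpace φ p R T),
        ENNReal.ofReal (c₁ / Real.sqrt K *
            Real.exp (c₂ * (1 - max (1 / 2) (K / (2 : ℝ) ^ ((R : ℤ) - 1))) * 2 ^ R))
          ≤ reconstructionConst K N ω T := by
  obtain ⟨d, hd, hr⟩ := hφ.exists_hasLowerRieszBound
  set L : ℝ := (∫ x, ‖φ x‖) + 1 with hL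
  have hL0 : 0 < L := by
    have : 0 ≤ ∫ x, ‖φ x‖ := integral_nonneg fun _ => norm_nonneg _
    linarith
  -- The bound `1` serves small `R`; the other one serves large `R`, its factor `2` absorbing `e^u ≤
  -- 2 cosh u`.
  set m : ℝ := min 1 (Real.sqrt d / (2 * L)) with hm
  have hsd : 0 < Real.sqrt d := Real.sqrt_pos.2 hd
  have hm0 : 0 < m := lt_min one_pos (by positivity)
  have hm1 : m ≤ 1 := min_le_left _ _
  have hm2 : m ^ 2 ≤ d / (4 * L ^ 2) := by
    calc m ^ 2 ≤ (Real.sqrt d / (2 * L)) ^ 2 := pow_le_pow_left₀ hm0.le (min_le_right _ _) 2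
      _ = d / (4 * L ^ 2) := by rw [div_pow, Real.sq_sqrt hd.le]; ring
  -- With `c₂ = 1/2` the exponent is `(1-z)2^{R-1}`. The factor `e^{-(p+1)}` pays for replacing
  -- `2^{R-1}` by `n = 2^{R-1} - p - 1`, and `24 = 12 · 2` combines `C₂ ≥ 1/12` with the total
  -- weight `2K`.
  refine ⟨Real.exp (-(p + 1)) * m / Real.sqrt 24, 1 / 2, by positivity, by norm_num, ?_⟩
  intro K hK N hN ω hω hωK R hR T hT
  have hK2 : 1 / 2 < K := lt_of_le_of_lt (by linarith [show 0 < 2 / Real.pi ^ 2 by positivity]) hK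
  have hK0 : 0 < K := by linarith
  rw [zpow_sub_one₀ two_ne_zero, zpow_natCast, ← div_eq_mul_inv] at hR ⊢
  have hR1 : 1 ≤ R := by
    by_contra! h
    obtain rfl : R = 0 := by omega
    norm_num at hR
    linarith
  set z : ℝ := max (1 / 2) (K / (2 ^ R / 2)) with hz
  have hpow : (0 : ℝ) < 2 ^ R := by positivity
  have hz0 : 1 / 2 ≤ z := le_max_left _ _
  have hz1 : z ≤ 1 := max_le (by norm_num) ((div_le_one (by positivity)).2 hR.le)
  have hzK : 2 * K ≤ z * 2 ^ R := by
    have h1 := (div_le_iff₀ (by positivity : (0 : ℝ) < 2 ^ R / 2)).1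
      (le_max_right (1 / 2) (K / (2 ^ R / 2)))
    rw [← hz] at h1
    linarith
  set q : ℝ := Real.exp (-(p + 1)) * Real.exp (1 / 2 * (1 - z) * 2 ^ R) with hq
  have hq0 : 0 < q := by positivity
  have hlhs : Real.exp (-(p + 1)) * m / Real.sqrt 24 / Real.sqrt K
      * Real.exp (1 / 2 * (1 - z) * 2 ^ R) = m * q / (Real.sqrt 24 * Real.sqrt K) := by
    rw [hq]
    field_simp
  have hsq : (m * q / (Real.sqrt 24 * Real.sqrt K)) ^ 2 = m ^ 2 * q ^ 2 / (24 * K) := by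
    rw [div_pow, mul_pow m q, mul_pow (Real.sqrt 24), Real.sq_sqrt (by norm_num), Real.sq_sqrt hK0.le]
  rw [hlhs]
  obtain ⟨r, rfl⟩ : ∃ r, R = r + 1 := ⟨R - 1, by omega⟩
  rcases le_or_gt (2 ^ r) p with hp | hp
  · obtain ⟨f, hfT, hf0⟩ := hT.exists_mem_ne_zero hd hr hsupp hR1
    have hfH := hT.le_unitIntervalSpace hfT
    refine le_trans (ENNReal.ofReal_le_ofReal ?_)
      (le_reconstructionConst hK2 hN hω hωK hfT hf0 (B := 2 * K) (by positivity)
        (samplingOp_re_le hN hω hωK hfH fun x _ =>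
          pow_le_pow_left₀ (norm_nonneg _) (norm_fourier_le hfH x) 2))
    refine Real.le_sqrt_of_sq_le ?_
    have hq1 : q ≤ 1 := by
      rw [hq, ← Real.exp_add, Real.exp_le_one_iff]
      have h1 : (2 : ℝ) ^ r ≤ p := by exact_mod_cast hp
      have h2 : (2 : ℝ) ^ (r + 1) = 2 * 2 ^ r := by ring
      rw [h2]
      nlinarith [show (0 : ℝ) < 2 ^ r by positivity]
    have h3 : m ^ 2 * q ^ 2 ≤ 1 := mul_le_one₀ (pow_le_one₀ hm0.le hm1) (by positivity)
      (pow_le_one₀ hq0.le hq1)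
    calc (m * q / (Real.sqrt 24 * Real.sqrt K)) ^ 2 = m ^ 2 * q ^ 2 / (24 * K) := hsq
      _ ≤ 1 / (24 * K) := by gcongr
      _ = 1 / 12 / (2 * K) := by rw [div_div]; ring
  -- The `2n+1` coefficients then need `2n + 1 + 2p = 2^R - 1` places, so they fit among the
  -- interior indices.
  · obtain ⟨n, hn⟩ : ∃ n, 2 ^ r = n + p + 1 := ⟨2 ^ r - p - 1, by omega⟩
    obtain ⟨f, hfT, hf0, hf⟩ := hT.exists_concentrated hd hr hsupp (n := n)
      (by rw [pow_succ]; omega) hz0 hz1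
    have hfH := hT.le_unitIntervalSpace hfT
    set c := Real.cosh (n * (1 - z)) with hc
    have hc0 : 0 < c := Real.cosh_pos _
    refine le_trans (ENNReal.ofReal_le_ofReal ?_)
      (le_reconstructionConst hK2 hN hω hωK hfT hf0 (B := 2 * K * (L ^ 2 / (d * c ^ 2)))
        (by positivity) ?_)
    · refine Real.le_sqrt_of_sq_le ?_
      have hqc : q ≤ 2 * c := by
        have h1 : q ≤ Real.exp (n * (1 - z)) := by
          rw [hq, ← Real.exp_add, Real.exp_le_exp]
          have h2 : (2 : ℝ) ^ r = n + p + 1 := by exact_mod_cast hn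
          have h3 : (2 : ℝ) ^ (r + 1) = 2 * 2 ^ r := by ring
          rw [h3, h2]
          nlinarith [show (0 : ℝ) ≤ p by positivity]
        rw [hc, Real.cosh_eq]
        linarith [Real.exp_pos (-(n * (1 - z)))]
      have hq2 : q ^ 2 ≤ (2 * c) ^ 2 := pow_le_pow_left₀ hq0.le hqc 2
      calc (m * q / (Real.sqrt 24 * Real.sqrt K)) ^ 2 = m ^ 2 * q ^ 2 / (24 * K) := hsq
        _ ≤ d / (4 * L ^ 2) * (2 * c) ^ 2 / (24 * K) := by gcongr
        _ = 1 / 12 / (2 * K * (L ^ 2 / (d * c ^ 2))) := by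
          field_simp
          ring
    · rw [mul_assoc (2 * K)]
      refine samplingOp_re_le hN hω hωK hfH fun x hx => hf x ?_
      have := abs_le.2 hx
      linarith
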